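/- Let $k$ be a field, let $n>0$, let $X=\mathbb P^n_k$, and let $Y$ be an integral linear subscheme of $X$ of codimension $r>0$, i.e. an integral closed subscheme of codimension $r$ that is defined (scheme-theoretically) by linear forms in the homogeneous coordinates. Let $\mathcal I$ be the ideal sheaf of $Y$, and put $$\beta(\mathcal O(1),Y)=\liminf_{N\to\infty}\frac{\sum_{m=1}^{\infty}h^0\bigl(X,\mathcal O(1)^{\otimes N}\otimes\mathcal I^m\bigr)}{N\,h^0\bigl(X,\mathcal O(1)^{\otimes N}\bigr)},$$ where $h^0(X,\mathcal F)=\dim_k H^0(X,\mathcal F)$. Then $$\beta(\mathcal O(1),Y)=\frac{r}{n+1}.$$ -/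

import Mathlib

open AlgebraicGeometry CategoryTheory TopologicalSpace Opposite Filter
open scoped ENNReal

universe u

noncomputable section

namespace BetaConst

/-! ### Sheaves of modules: tensor products, tensor powers, dimension of global sections -/

section Sheaves

variable {X : Scheme.{u}}

/-- The tensor product `F ⊗ G` of two sheaves of `𝒪_X`-modules: the sheaf associated to the
presheaf `U ↦ F(U) ⊗_{𝒪_X(U)} G(U)`. -/
def sheafTensor (F G : X.Modules) : X.Modules :=
  (PresheafOfModules.sheafification (𝟙 X.ringCatSheaf.obj)).obj
    (PresheafOfModules.Monoidal.tensorObj (R := X.presheaf) F.val G.val)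

/-- The structure sheaf `𝒪_X` as a module over itself. -/
def structureModule (X : Scheme.{u}) : X.Modules :=
  SheafOfModules.unit X.ringCatSheaf

/-- The tensor power `L^N = L ⊗ ⋯ ⊗ L` (`N` factors), with `L^0 = 𝒪_X`. -/
def tensorPow (L : X.Modules) : ℕ → X.Modules
  | 0 => structureModule X
  | N + 1 => sheafTensor (tensorPow L N) L

open Scheme.Modules in
/-- `h⁰(X, F) = dim_k H⁰(X, F)`, an element of `ℕ ∪ {∞}`, for a sheaf of modules `F` on a scheme
`X` over `Spec k` with structure morphism `f`. The field `k` acts on `H⁰(X, F) = F(X)` through the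
ring homomorphism `k → 𝒪_X(X)` given by `f`. -/
def h0 {k : Type u} [Field k] (f : X ⟶ Spec (.of k)) (F : X.Modules) : ℕ∞ :=
  letI : Module k Γ(F, ⊤) :=
    Module.compHom Γ(F, ⊤) ((Scheme.ΓSpecIso (.of k)).inv ≫ f.appTop).hom
  Cardinal.toENat (Module.rank k Γ(F, ⊤))

end Sheaves

/-! ### Quasi-coherent ideal sheaves as sheaves of modules -/

section IdealSheaf

variable {X : Scheme.{u}} (I : X.IdealSheafData)

/-- Local membership in the ideal sheaf `I`: the section `s` of `𝒪_X` over `U` restricts, near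
every point of `U`, to an element of `I(V)` for some affine open `V`. -/
def LocallyMem {U : X.Opens} (s : Γ(X, U)) : Prop :=
  ∀ x ∈ U, ∃ (V : X.affineOpens) (h : V.1 ≤ U), x ∈ V.1 ∧
    X.presheaf.map (homOfLE h).op s ∈ I.ideal V

lemma LocallyMem.res {U V : X.Opens} (h : V ≤ U) {s : Γ(X, U)} (hs : LocallyMem I s) :
    LocallyMem I (X.presheaf.map (homOfLE h).op s) := by
  intro x hx
  obtain ⟨W, hW, hxW, hsW⟩ := hs x (h hx)
  obtain ⟨_, ⟨W', hW', rfl⟩, hxW', hle⟩ :=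
    X.isBasis_affineOpens.exists_subset_of_mem_open (a := x) (u := (W.1 ⊓ V : X.Opens))
      ⟨hxW, hx⟩ (W.1 ⊓ V).isOpen
  have hl : W' ≤ W.1 ⊓ V := hle
  refine ⟨⟨W', hW'⟩, hl.trans inf_le_right, hxW', ?_⟩
  have := I.ideal_le_comap_ideal (U := ⟨W', hW'⟩) (V := W) (hl.trans inf_le_left) hsW
  rw [Ideal.mem_comap] at this
  rw [← ConcreteCategory.comp_apply, ← Functor.map_comp] at this ⊢
  exact this

lemma LocallyMem.add {U : X.Opens} {s t : Γ(X, U)} (hs : LocallyMem I s)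
    (ht : LocallyMem I t) : LocallyMem I (s + t) := by
  intro x hx
  obtain ⟨W, hW, hxW, hsW⟩ := hs x hx
  obtain ⟨W', hW', hxW', hsW'⟩ := LocallyMem.res I hW ht x hxW
  refine ⟨W', hW'.trans hW, hxW', ?_⟩
  have := I.ideal_le_comap_ideal (U := W') (V := W) hW' hsW
  rw [Ideal.mem_comap] at this
  rw [← ConcreteCategory.comp_apply, ← Functor.map_comp] at this hsW'
  rw [map_add]
  exact add_mem this hsW'

/-- The sections of an ideal sheaf over an open set, as an ideal of `𝒪_X(U)`. -/
def idealSections (U : X.Opens) : Ideal Γ(X, U) where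
  carrier := {s | LocallyMem I s}
  add_mem' hs ht := LocallyMem.add I hs ht
  zero_mem' := by
    intro x hx
    obtain ⟨_, ⟨V, hV, rfl⟩, hxV, hle⟩ :=
      X.isBasis_affineOpens.exists_subset_of_mem_open (a := x) (u := U) hx U.isOpen
    exact ⟨⟨V, hV⟩, hle, hxV, by rw [map_zero]; exact zero_mem _⟩
  smul_mem' c s hs := by
    intro x hx
    obtain ⟨V, hV, hxV, hsV⟩ := hs x hx
    exact ⟨V, hV, hxV, by rw [smul_eq_mul, map_mul]; exact Ideal.mul_mem_left _ _ hsV⟩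

/-- An ideal sheaf as a presheaf of submodules of `𝒪_X`. -/
def idealSubmodule : PresheafOfModules.Submodule (structureModule X).val where
  obj U := idealSections I U.unop
  map f := fun _ hs ↦ LocallyMem.res I f.unop.le hs

/-- An ideal sheaf as a subpresheaf of sets of `𝒪_X`. -/
def idealSubfunctor : Subfunctor (X.presheaf ⋙ forget CommRingCat) where
  obj U := {s | LocallyMem I (U := U.unop) s}
  map f := fun _ hs ↦ LocallyMem.res I f.unop.le hs

/-- The ideal sheaf `I ⊆ 𝒪_X` as a sheaf of `𝒪_X`-modules. -/
def idealModule : X.Modules where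
  val := (idealSubmodule I).toPresheafOfModules
  isSheaf := by
    refine (TopCat.Presheaf.isSheaf_iff_isSheaf_comp (forget AddCommGrpCat) _).2 ?_
    refine (isSheaf_iff_isSheaf_of_type _ _).2 ?_
    change Presieve.IsSheaf _ (idealSubfunctor I).toFunctor
    refine ((idealSubfunctor I).isSheaf_iff ?_).2 ?_
    · exact (isSheaf_iff_isSheaf_of_type _ _).1
        ((TopCat.Presheaf.isSheaf_iff_isSheaf_comp (forget CommRingCat) _).1 X.sheaf.2)
    · intro U s hs x hx
      obtain ⟨V, f, hf, hxV⟩ := hs x hx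
      obtain ⟨W, hW, hxW, hsW⟩ := (show LocallyMem I (X.presheaf.map f.op s) from hf) x hxV
      refine ⟨W, hW.trans f.le, hxW, ?_⟩
      rw [← ConcreteCategory.comp_apply, ← Functor.map_comp] at hsW
      exact hsW

end IdealSheaf

/-! ### The constant `β(L, Y)` -/

section Beta

variable {X Y : Scheme.{u}}

/-- For a scheme `X` over a field `k` with structure morphism `f`, a line sheaf `L` on `X` and a
closed subscheme `i : Y ⟶ X` with ideal sheaf `I`,
`β(L, Y) = liminf_{N → ∞} (∑_{m ≥ 1} h⁰(X, L^N ⊗ I^m)) / (N h⁰(X, L^N))`,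
as an element of `[0, ∞]`. -/
def beta {k : Type u} [Field k] (f : X ⟶ Spec (.of k)) (L : X.Modules) (i : Y ⟶ X) : ℝ≥0∞ :=
  liminf (fun N : ℕ ↦
    (∑' m : ℕ, (h0 f (sheafTensor (tensorPow L N) (idealModule (i.ker ^ (m + 1)))) : ℝ≥0∞)) /
      ((N : ℝ≥0∞) * (h0 f (tensorPow L N) : ℝ≥0∞))) atTop

/-- The codimension in `X` of an irreducible closed subscheme `i : Y ⟶ X`: the supremum of the
lengths of the chains of irreducible closed subsets of `X` starting with (the image of) `Y`. -/
def codim (i : Y ⟶ X) [IsClosedImmersion i] [IrreducibleSpace Y] : ℕ∞ :=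
  Order.coheight (⟨Set.range i, by
      rw [← Set.image_univ]
      exact (IrreducibleSpace.isIrreducible_univ Y).image i i.continuous.continuousOn,
    i.isClosedEmbedding.isClosed_range⟩ : IrreducibleCloseds X)

end Beta

/-! ### Twisting sheaves on `Proj` -/

section Twist

variable {σ : Type*} {A : Type u} [CommRing A] [SetLike σ A] [AddSubgroupClass σ A]
variable (𝒜 : ℕ → σ) [GradedRing 𝒜] (d : ℕ)

/-- The local ring of `A` at the homogeneous prime ideal `x`. -/
abbrev LocAt (x : ProjectiveSpectrum 𝒜) : Type u :=
  Localization.AtPrime x.asHomogeneousIdeal.toIdeal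

/-- A function `f` on an open set `U` of `Proj A`, with values in the local rings of `A`, is a
fraction of degree `d` if `f = a / b` on `U` with `a` and `b` homogeneous,
`deg a = deg b + d`, and `b` vanishing nowhere on `U`. -/
def IsFractionOfDegree {U : Opens (ProjectiveSpectrum.top 𝒜)} (f : ∀ x : U, LocAt 𝒜 x.1) : Prop :=
  ∃ (j : ℕ) (a : 𝒜 (j + d)) (b : 𝒜 j) (hb : ∀ x : U, b.1 ∉ x.1.asHomogeneousIdeal),
    ∀ x : U, f x = Localization.mk a.1 ⟨b.1, hb x⟩

/-- The local predicate "locally a fraction of degree `d`". -/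
def locallyFraction : TopCat.LocalPredicate (fun x : ProjectiveSpectrum.top 𝒜 ↦ LocAt 𝒜 x) :=
  TopCat.PrelocalPredicate.sheafify
    { pred := fun f ↦ IsFractionOfDegree 𝒜 d f
      res := by
        rintro U V i f ⟨j, a, b, hb, h⟩
        exact ⟨j, a, b, fun x ↦ hb (i x), fun x ↦ h (i x)⟩ }

/-- The sections of `𝒪(d)` over `U`: the functions on `U` that are locally fractions of
degree `d`. -/
def twistSections (U : Opens (ProjectiveSpectrum.top 𝒜)) :
    AddSubgroup (∀ x : U, LocAt 𝒜 x.1) where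
  carrier := {f | (locallyFraction 𝒜 d).pred f}
  zero_mem' := fun x ↦ ⟨U, x.2, 𝟙 U, 0, ⟨0, zero_mem _⟩, ⟨1, SetLike.one_mem_graded _⟩,
    fun y ↦ (Ideal.ne_top_iff_one _).1 y.1.isPrime.ne_top, fun _ ↦ (Localization.mk_zero _).symm⟩
  add_mem' := by
    intro f g hf hg x
    obtain ⟨V, hxV, iV, j, a, b, hb, h⟩ := hf x
    obtain ⟨V', hxV', iV', j', a', b', hb', h'⟩ := hg x
    refine ⟨V ⊓ V', ⟨hxV, hxV'⟩, Opens.infLELeft _ _ ≫ iV, j + j',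
      ⟨b.1 * a'.1 + b'.1 * a.1, add_mem ?_ ?_⟩, ⟨b.1 * b'.1, SetLike.mul_mem_graded b.2 b'.2⟩,
      fun y h ↦ (y.1.isPrime.mem_or_mem h).elim (hb ⟨y.1, y.2.1⟩) (hb' ⟨y.1, y.2.2⟩),
      fun y ↦ ?_⟩
    · rw [add_assoc]; exact SetLike.mul_mem_graded b.2 a'.2
    · rw [show j + j' + d = j' + (j + d) by omega]; exact SetLike.mul_mem_graded b'.2 a.2
    · have e := h ⟨y.1, y.2.1⟩
      have e' := h' ⟨y.1, y.2.2⟩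
      refine (congrArg₂ (· + ·) e e').trans ?_
      rw [Localization.add_mk]
      rfl
  neg_mem' := by
    intro f hf x
    obtain ⟨V, hxV, iV, j, a, b, hb, h⟩ := hf x
    refine ⟨V, hxV, iV, j, ⟨-a.1, neg_mem a.2⟩, b, hb, fun y ↦ ?_⟩
    exact (congrArg Neg.neg (h y)).trans (Localization.neg_mk _ _)

/-- A regular function times a section of `𝒪(d)` is a section of `𝒪(d)`. -/
lemma smul_mem_twistSections {U : Opens (ProjectiveSpectrum.top 𝒜)}
    (s : (ProjectiveSpectrum.Proj.structureSheaf 𝒜).1.obj (op U)) {f : ∀ x : U, LocAt 𝒜 x.1}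
    (hf : f ∈ twistSections 𝒜 d U) :
    (fun x : U ↦ (s.1 x).val * f x) ∈ twistSections 𝒜 d U := by
  intro x
  obtain ⟨V, hxV, iV, j, a, b, hb, h⟩ := hf x
  obtain ⟨V', hxV', iV', j', a', b', hb', h'⟩ := s.2 x
  refine ⟨V ⊓ V', ⟨hxV, hxV'⟩, Opens.infLELeft _ _ ≫ iV, j' + j,
    ⟨a'.1 * a.1, ?_⟩, ⟨b'.1 * b.1, SetLike.mul_mem_graded b'.2 b.2⟩,
    fun y h ↦ (y.1.isPrime.mem_or_mem h).elim (hb' ⟨y.1, y.2.2⟩) (hb ⟨y.1, y.2.1⟩),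
    fun y ↦ ?_⟩
  · rw [add_assoc]; exact SetLike.mul_mem_graded a'.2 a.2
  · have e := h ⟨y.1, y.2.1⟩
    have e' := congrArg HomogeneousLocalization.val (h' ⟨y.1, y.2.2⟩)
    refine (congrArg₂ (· * ·) e' e).trans ?_
    rw [HomogeneousLocalization.val_mk, Localization.mk_mul]
    rfl

/-- `𝒪(d)` as a presheaf of abelian groups; the restriction maps restrict functions. -/
def twistPresheaf : (Opens (ProjectiveSpectrum.top 𝒜))ᵒᵖ ⥤ Ab.{u} where
  obj U := AddCommGrpCat.of (twistSections 𝒜 d U.unop)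
  map i := AddCommGrpCat.ofHom
    { toFun := fun f ↦ ⟨fun x ↦ f.1 (i.unop x), (locallyFraction 𝒜 d).res i.unop f.1 f.2⟩
      map_zero' := rfl
      map_add' := fun _ _ ↦ rfl }

/-- Regular functions act on the sections of `𝒪(d)` by pointwise multiplication in the local
rings of `A`. -/
instance twistSectionsModule (U : (Opens (ProjectiveSpectrum.top 𝒜))ᵒᵖ) :
    Module ((ProjectiveSpectrum.Proj.structureSheaf 𝒜).1.obj U) ((twistPresheaf 𝒜 d).obj U) where
  smul s f := ⟨fun x ↦ (s.1 x).val * f.1 x, smul_mem_twistSections 𝒜 d s f.2⟩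
  one_smul f := Subtype.ext (funext fun x ↦
    (congrArg (· * f.1 x) HomogeneousLocalization.val_one).trans (one_mul _))
  mul_smul s t f := Subtype.ext (funext fun x ↦
    (congrArg (· * f.1 x) (HomogeneousLocalization.val_mul (s.1 x) (t.1 x))).trans
      (mul_assoc _ _ _))
  smul_zero _ := Subtype.ext (funext fun _ ↦ mul_zero _)
  smul_add _ _ _ := Subtype.ext (funext fun _ ↦ mul_add _ _ _)
  add_smul s t f := Subtype.ext (funext fun x ↦
    (congrArg (· * f.1 x) (HomogeneousLocalization.val_add (s.1 x) (t.1 x))).trans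
      (add_mul _ _ _))
  zero_smul f := Subtype.ext (funext fun x ↦
    (congrArg (· * f.1 x) HomogeneousLocalization.val_zero).trans (zero_mul _))

/-- The twisting sheaf `𝒪(d)`, `d ≥ 0`, on `Proj A`, as a sheaf of modules. -/
def twist : (Proj 𝒜).Modules where
  val :=
    letI (U : (Opens (Proj 𝒜))ᵒᵖ) :
        Module ((Proj 𝒜).ringCatSheaf.obj.obj U) ((twistPresheaf 𝒜 d).obj U) :=
      twistSectionsModule 𝒜 d U
    PresheafOfModules.ofPresheaf (twistPresheaf 𝒜 d) (fun _ _ _ _ _ ↦ rfl)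
  isSheaf := (TopCat.Presheaf.isSheaf_iff_isSheaf_comp (forget AddCommGrpCat) _).2
    (TopCat.subsheafToTypes (locallyFraction 𝒜 d)).2

end Twist

/-! ### Projective space and its linear subschemes -/

section ProjectiveSpace

open MvPolynomial

attribute [local instance] MvPolynomial.gradedAlgebra

variable (n : ℕ) (k : Type u) [Field k]

/-- Projective space `ℙⁿ_k = Proj k[x_0, …, x_n]`. -/
abbrev PSpace : Scheme.{u} := Proj (homogeneousSubmodule (Fin (n + 1)) k)

/-- The structure morphism `ℙⁿ_k ⟶ Spec k`. -/
def PSpace.toSpec : PSpace n k ⟶ Spec (.of k) :=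
  Proj.toSpecZero (homogeneousSubmodule (Fin (n + 1)) k) ≫
    Spec.map (CommRingCat.ofHom (algebraMap k (homogeneousSubmodule (Fin (n + 1)) k 0)))

/-- The line sheaf `𝒪(1)` on `ℙⁿ_k`. -/
def PSpace.O1 : (PSpace n k).Modules := twist (homogeneousSubmodule (Fin (n + 1)) k) 1

variable {n k}

lemma X_mem (j : Fin (n + 1)) : (X j : MvPolynomial (Fin (n + 1)) k) ∈
    homogeneousSubmodule (Fin (n + 1)) k 1 :=
  (mem_homogeneousSubmodule 1 _).2 (isHomogeneous_X k j)

/-- The standard affine open subset `D₊(x_j)` of `ℙⁿ_k`. -/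
def PSpace.chart (j : Fin (n + 1)) : (PSpace n k).affineOpens :=
  ⟨Proj.basicOpen (homogeneousSubmodule (Fin (n + 1)) k) (X j),
    Proj.isAffineOpen_basicOpen _ (X j) (X_mem j) one_pos⟩

/-- The regular function `ℓ / x_j` on `D₊(x_j)`, for a linear form `ℓ`. -/
def PSpace.dehomogenize (j : Fin (n + 1)) (ℓ : homogeneousSubmodule (Fin (n + 1)) k 1) :
    Γ(PSpace n k, (PSpace.chart j).1) :=
  (Proj.awayToSection (homogeneousSubmodule (Fin (n + 1)) k) (X j)).hom
    (HomogeneousLocalization.Away.mk _ (X_mem j) 1 ℓ.1 (by rw [one_smul]; exact ℓ.2))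

/-- A closed subscheme `i : Y ⟶ ℙⁿ_k` is linear if it is the closed subscheme defined by linear
forms: for some linear space `W` of linear forms, its ideal on each chart `D₊(x_j)` is generated by the functions
`ℓ / x_j`, `ℓ ∈ W`. -/
def IsLinearSubscheme {Y : Scheme.{u}} (i : Y ⟶ PSpace n k) [IsClosedImmersion i] : Prop :=
  ∃ W : Submodule k (homogeneousSubmodule (Fin (n + 1)) k 1),
    ∀ j, i.ker.ideal (PSpace.chart j) = Ideal.span (PSpace.dehomogenize j '' (W : Set _))

end ProjectiveSpace

end BetaConst

end

/-! ### Tensor products of sheaves of modules computed from bilinear maps on sections -/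

noncomputable section

namespace BetaConst

/-! In suitable linear coordinates `Y` is cut out by the variables indexed by a set `T` with `r`
elements. Let `J` be the homogeneous ideal generated by the linear forms in `W`. In these
coordinates `J ^ m` is spanned by the monomials of degree at least `m` in the variables of `T`
(`span_X_pow_eq`), and for `N > 0` the space `H⁰(𝒪(1)^N ⊗ I^m)` is the degree `N` part of `J ^ m`.
Summing dimensions over `m ≥ 1` counts each monomial of degree `N` as often as its degree in `T`
(`tsum_card_filter`). Permuting the variables shows that every variable has the same total exponent
over all monomials of degree `N`, namely `N h⁰(𝒪(N)) / (n + 1)` (`card_mul_sum_partialDegree`). The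
numerator is therefore `r N h⁰(𝒪(N)) / (n + 1)`: the quotient equals `r / (n + 1)` for every `N >
0`, and the lower limit is that of a constant.

The geometric work is to identify the spaces of sections. Tensor products are sheafifications, so
each is replaced by a concrete sheaf by means of a bilinear map that is locally a tensor product
(`sheafTensorIso`): `𝒪(1)^N` by `𝒪(N)`, and `𝒪(N) ⊗ I^m` by the subsheaf `I^m 𝒪(N)`. Sections of
`𝒪(N)` are forms of degree `N` (`twistOf_surjective`). A form whose section lies in `I^m 𝒪(N)` lies
in `J ^ m` only up to a power of some `x_j`, so a variable is needed that is a nonzerodivisor modulo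
`J ^ m`. Since `Y` is nonempty, some `x_j` is not in `W`, and `exists_adapted_coordinates` makes
this `x_j` a coordinate outside `T`.

Finally `T.card = r` (`codim_eq_card`): a chain of coordinate subspaces bounds the codimension
below, and Krull's height theorem bounds it above. -/

/-- A locally bijective morphism from a presheaf of modules to a sheaf identifies the associated
sheaf with its target. -/
def sheafificationIsoOfLocallyBijective {C : Type*} [Category* C] {J : GrothendieckTopology C}
    (R : Sheaf J RingCat.{u}) [J.WEqualsLocallyBijective AddCommGrpCat.{u}]
    [HasWeakSheafify J AddCommGrpCat.{u}] {P : PresheafOfModules.{u} R.obj}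
    (H : SheafOfModules.{u} R) (φ : P ⟶ H.val)
    (hi : Presheaf.IsLocallyInjective J ((PresheafOfModules.toPresheaf R.obj).map φ))
    (hs : Presheaf.IsLocallySurjective J ((PresheafOfModules.toPresheaf R.obj).map φ)) :
    (PresheafOfModules.sheafification (𝟙 R.obj)).obj P ≅ H :=
  -- Sheafification inverts the locally bijective morphisms, and the counit is invertible at a
  -- sheaf.
  haveI : IsIso ((PresheafOfModules.sheafification (𝟙 R.obj)).map φ) := by
    have key : J.W.inverseImage (PresheafOfModules.toPresheaf R.obj) φ := by
      rw [MorphismProperty.inverseImage_iff, GrothendieckTopology.W_iff_isLocallyBijective]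
      exact ⟨hi, hs⟩
    rwa [PresheafOfModules.inverseImage_W_toPresheaf_eq_inverseImage_isomorphisms
      (𝟙 R.obj)] at key
  asIso ((PresheafOfModules.sheafification (𝟙 R.obj)).map φ) ≪≫
    (asIso (PresheafOfModules.sheafificationAdjunction.{u} (𝟙 R.obj)).counit).app H

open Scheme.Modules

variable {X : Scheme.{u}} {F G H : X.Modules}

open MonoidalCategory in
/-- The morphism from the presheaf tensor product given by bilinear maps on sections. -/
def tensorDesc (μ : ∀ U : X.Opens, Γ(F, U) →ₗ[Γ(X, U)] Γ(G, U) →ₗ[Γ(X, U)] Γ(H, U))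
    (hμ : ∀ (U V : X.Opens) (i : V ⟶ U) (a : Γ(F, U)) (b : Γ(G, U)),
      H.presheaf.map i.op (μ U a b) = μ V (F.presheaf.map i.op a) (G.presheaf.map i.op b)) :
    PresheafOfModules.Monoidal.tensorObj (R := X.presheaf) F.val G.val ⟶ H.val where
  app U := ModuleCat.ofHom (R := Γ(X, U.unop))
    (X := (TensorProduct Γ(X, U.unop) Γ(F, U.unop) Γ(G, U.unop)))
    (Y := Γ(H, U.unop)) (TensorProduct.lift (μ U.unop))
  naturality {U V} i := ModuleCat.MonoidalCategory.tensor_ext (fun a b ↦ by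
    exact (hμ _ _ i.unop a b).symm)

/-- A compatible family of bilinear maps on sections that is locally a tensor product identifies the
tensor product of sheaves. -/
def sheafTensorIso (μ : ∀ U : X.Opens, Γ(F, U) →ₗ[Γ(X, U)] Γ(G, U) →ₗ[Γ(X, U)] Γ(H, U))
    (hμ : ∀ (U V : X.Opens) (i : V ⟶ U) (a : Γ(F, U)) (b : Γ(G, U)),
      H.presheaf.map i.op (μ U a b) = μ V (F.presheaf.map i.op a) (G.presheaf.map i.op b))
    (hloc : ∀ x : X, ∃ U : X.Opens, x ∈ U ∧
      ∀ V ≤ U, Function.Bijective (TensorProduct.lift (μ V))) :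
    sheafTensor F G ≅ H :=
  sheafificationIsoOfLocallyBijective X.ringCatSheaf H (tensorDesc μ hμ)
    (by
      constructor
      intro U a b h x hx
      obtain ⟨W, hxW, hW⟩ := hloc x
      refine ⟨U.unop ⊓ W, homOfLE inf_le_left, ?_, hx, hxW⟩
      apply (hW _ inf_le_right).1
      have nat := fun c ↦ NatTrans.naturality_apply
        ((PresheafOfModules.toPresheaf X.ringCatSheaf.obj).map (tensorDesc μ hμ))
        (homOfLE (inf_le_left : U.unop ⊓ W ≤ U.unop)).op c
      exact (nat a).trans ((congrArg _ h).trans (nat b).symm))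
    (by
      constructor
      intro U s x hx
      obtain ⟨W, hxW, hW⟩ := hloc x
      refine ⟨U ⊓ W, homOfLE inf_le_left, ?_, hx, hxW⟩
      exact (hW _ inf_le_right).2 _)

open MonoidalCategory in
/-- The tensor product of isomorphisms of sheaves of modules. -/
def sheafTensorCongr {F' G' : X.Modules} (e : F ≅ F') (e' : G ≅ G') :
    sheafTensor F G ≅ sheafTensor F' G' where
  hom := (PresheafOfModules.sheafification (𝟙 X.ringCatSheaf.obj)).map
    (PresheafOfModules.Monoidal.tensorHom (R := X.presheaf) e.hom.val e'.hom.val)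
  inv := (PresheafOfModules.sheafification (𝟙 X.ringCatSheaf.obj)).map
    (PresheafOfModules.Monoidal.tensorHom (R := X.presheaf) e.inv.val e'.inv.val)
  hom_inv_id := by
    refine ((PresheafOfModules.sheafification (𝟙 X.ringCatSheaf.obj)).map_comp _ _).symm.trans
      ((congrArg _ ?_).trans ((PresheafOfModules.sheafification (𝟙 X.ringCatSheaf.obj)).map_id _))
    refine (tensorHom_comp_tensorHom (C := PresheafOfModules (X.presheaf ⋙ forget₂ _ _))
      e.hom.val e'.hom.val e.inv.val e'.inv.val).trans ?_
    exact (congrArg₂ _ congr($(e.hom_inv_id).val) congr($(e'.hom_inv_id).val)).trans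
      (id_tensorHom_id (C := PresheafOfModules (X.presheaf ⋙ forget₂ _ _)) _ _)
  inv_hom_id := by
    refine ((PresheafOfModules.sheafification (𝟙 X.ringCatSheaf.obj)).map_comp _ _).symm.trans
      ((congrArg _ ?_).trans ((PresheafOfModules.sheafification (𝟙 X.ringCatSheaf.obj)).map_id _))
    refine (tensorHom_comp_tensorHom (C := PresheafOfModules (X.presheaf ⋙ forget₂ _ _))
      e.inv.val e'.inv.val e.hom.val e'.hom.val).trans ?_
    exact (congrArg₂ _ congr($(e.inv_hom_id).val) congr($(e'.inv_hom_id).val)).trans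
      (id_tensorHom_id (C := PresheafOfModules (X.presheaf ⋙ forget₂ _ _)) _ _)

-- Because `e` generates `M`, every tensor is pure of the form `e ⊗ b`, so the lift is `μ e` in
-- disguise. Freeness of `M` is not needed.
open TensorProduct in
lemma lift_bijective_of_generator {R M N P : Type*} [CommRing R] [AddCommGroup M] [AddCommGroup N]
    [AddCommGroup P] [Module R M] [Module R N] [Module R P] (μ : M →ₗ[R] N →ₗ[R] P) (e : M)
    (he : Function.Surjective fun r : R ↦ r • e) (hμ : Function.Bijective (μ e)) :
    Function.Bijective (TensorProduct.lift μ) := by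
  have h : ∀ t : M ⊗[R] N, ∃ b, t = e ⊗ₜ b := by
    intro t
    induction t with
    | zero => exact ⟨0, by simp⟩
    | tmul a b =>
      obtain ⟨r, rfl⟩ := he a
      exact ⟨r • b, by simp [TensorProduct.smul_tmul]⟩
    | add s t hs ht =>
      obtain ⟨a, rfl⟩ := hs
      obtain ⟨b, rfl⟩ := ht
      exact ⟨a + b, by rw [TensorProduct.tmul_add]⟩
  constructor
  · rw [injective_iff_map_eq_zero]
    intro t ht
    obtain ⟨b, rfl⟩ := h t
    rw [TensorProduct.lift.tmul] at ht
    rw [(injective_iff_map_eq_zero _).1 hμ.1 b ht, TensorProduct.tmul_zero]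
  · intro p
    obtain ⟨b, rfl⟩ := hμ.2 p
    exact ⟨e ⊗ₜ b, by simp⟩

/-- Scalars act through global functions, so an isomorphism of sheaves of modules is automatically
`k`-linear on global sections. -/
lemma h0_congr {k : Type u} [Field k] (f : X ⟶ Spec (.of k)) (e : F ≅ G) : h0 f F = h0 f G := by
  let : Module k Γ(F, ⊤) :=
    Module.compHom Γ(F, ⊤) ((Scheme.ΓSpecIso (.of k)).inv ≫ f.appTop).hom
  let : Module k Γ(G, ⊤) :=
    Module.compHom Γ(G, ⊤) ((Scheme.ΓSpecIso (.of k)).inv ≫ f.appTop).hom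
  unfold h0
  congr 1
  exact LinearEquiv.rank_eq
    { toFun := e.hom.app ⊤
      invFun := e.inv.app ⊤
      map_add' := fun a b ↦ map_add _ a b
      map_smul' := fun r a ↦ Hom.app_smul e.hom _ a
      left_inv := fun a ↦ by
        have := congr($(e.hom_inv_id).app ⊤ a)
        exact this
      right_inv := fun a ↦ by
        have := congr($(e.inv_hom_id).app ⊤ a)
        exact this }

end BetaConst

end

/-! ### The subsheaf `I F` of an invertible sheaf `F` -/

noncomputable section

namespace BetaConst

open Scheme.Modules

variable {X : Scheme.{u}}

/-- `e` generates `F` freely over every open subset of `U`. -/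
def IsGenerator {F : X.Modules} {U : X.Opens} (e : Γ(F, U)) : Prop :=
  ∀ (V : X.Opens) (h : V ≤ U),
    Function.Bijective fun f : Γ(X, V) ↦ f • F.presheaf.map (homOfLE h).op e

lemma modules_map_map (F : X.Modules) {U V W : X.Opens} (h : V ≤ U) (h' : W ≤ V) (s : Γ(F, U)) :
    F.presheaf.map (homOfLE h').op (F.presheaf.map (homOfLE h).op s) =
      F.presheaf.map (homOfLE (h'.trans h)).op s := by
  rw [← ConcreteCategory.comp_apply, ← Functor.map_comp]
  rfl

lemma modules_map_self (F : X.Modules) {U : X.Opens} (s : Γ(F, U)) :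
    F.presheaf.map (homOfLE le_rfl : U ⟶ U).op s = s := by
  rw [show (homOfLE le_rfl : U ⟶ U).op = 𝟙 _ from rfl, CategoryTheory.Functor.map_id]
  rfl

lemma IsGenerator.res {F : X.Modules} {U V : X.Opens} {e : Γ(F, U)} (he : IsGenerator e)
    (h : V ≤ U) : IsGenerator (F.presheaf.map (homOfLE h).op e) := by
  intro W hW
  simpa only [modules_map_map] using he W (hW.trans h)

lemma IsGenerator.bijective {F : X.Modules} {U : X.Opens} {e : Γ(F, U)} (he : IsGenerator e) :
    Function.Bijective fun f : Γ(X, U) ↦ f • e := by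
  simpa only [modules_map_self] using he U le_rfl

variable (I : X.IdealSheafData) (F : X.Modules)

/-- The sections of the subsheaf `I F` of `F`. -/
def idealTwistSections (U : X.Opens) : Submodule Γ(X, U) Γ(F, U) where
  -- Testing against every local generator avoids choosing a trivialisation. The condition is
  -- vacuous over opens without generators, so this is `I F` only for `F` locally free of rank one.
  carrier := {s | ∀ (V : X.Opens) (h : V ≤ U) (e : Γ(F, V)), IsGenerator e → ∀ f : Γ(X, V),
    f • e = F.presheaf.map (homOfLE h).op s → LocallyMem I f}
  add_mem' := by
    intro s t hs ht V h e he f hf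
    obtain ⟨a, ha⟩ := he.bijective.2 (F.presheaf.map (homOfLE h).op s)
    obtain ⟨b, hb⟩ := he.bijective.2 (F.presheaf.map (homOfLE h).op t)
    dsimp only at ha hb
    have : f = a + b := he.bijective.1 (by
      change f • e = (a + b) • e
      rw [add_smul, ha, hb, hf, map_add])
    rw [this]
    exact (hs V h e he a ha).add I (ht V h e he b hb)
  zero_mem' := by
    intro V h e he f hf
    have : f = 0 := he.bijective.1 (by
      change f • e = (0 : Γ(X, V)) • e
      rw [hf, zero_smul, map_zero])
    rw [this]
    exact (idealSections I V).zero_mem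
  smul_mem' := by
    intro c s hs V h e he f hf
    obtain ⟨a, ha⟩ := he.bijective.2 (F.presheaf.map (homOfLE h).op s)
    dsimp only at ha
    have : f = X.presheaf.map (homOfLE h).op c * a := he.bijective.1 (by
      change f • e = (_ * a) • e
      rw [mul_smul, ha, hf, Scheme.Modules.map_smul])
    rw [this]
    exact (idealSections I V).mul_mem_left _ (hs V h e he a ha)

variable {F} in
lemma res_mem_idealTwistSections {U V : X.Opens} (h : V ≤ U) {s : Γ(F, U)}
    (hs : s ∈ idealTwistSections I F U) :
    F.presheaf.map (homOfLE h).op s ∈ idealTwistSections I F V := by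
  intro W hW e he f hf
  rw [modules_map_map] at hf
  exact hs W (hW.trans h) e he f hf

/-- The subsheaf `I F` of `F`, as a presheaf of submodules. -/
def idealTwistSubmodule : PresheafOfModules.Submodule F.val where
  obj U := idealTwistSections I F U.unop
  map f := fun _ hs ↦ res_mem_idealTwistSections I f.unop.le hs

/-- The subsheaf `I F` of `F`, as a subpresheaf of sets. -/
def idealTwistSubfunctor : Subfunctor (F.presheaf ⋙ forget AddCommGrpCat) where
  obj U := {s | s ∈ idealTwistSections I F U.unop}
  map f := fun _ hs ↦ res_mem_idealTwistSections I f.unop.le hs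

variable {I F} in
lemma mem_idealTwistSections_of_local {U : X.Opens} {s : Γ(F, U)}
    (hs : ∀ x ∈ U, ∃ (V : X.Opens) (h : V ≤ U), x ∈ V ∧
      F.presheaf.map (homOfLE h).op s ∈ idealTwistSections I F V) :
    s ∈ idealTwistSections I F U := by
  intro W hW e he f hf x hx
  obtain ⟨V, h, hxV, hV⟩ := hs x (hW hx)
  have := hV (W ⊓ V) inf_le_right _ (he.res inf_le_left)
    (X.presheaf.map (homOfLE inf_le_left).op f) (by
      rw [← Scheme.Modules.map_smul, hf, modules_map_map, modules_map_map])
  obtain ⟨V', h', hxV', hm⟩ := this x ⟨hx, hxV⟩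
  refine ⟨V', h'.trans inf_le_left, hxV', ?_⟩
  rw [← ConcreteCategory.comp_apply, ← Functor.map_comp] at hm
  exact hm

/-- The subsheaf `I F` of `F`. -/
def idealTwist : X.Modules where
  val := (idealTwistSubmodule I F).toPresheafOfModules
  isSheaf := by
    refine (TopCat.Presheaf.isSheaf_iff_isSheaf_comp (forget AddCommGrpCat) _).2 ?_
    refine (isSheaf_iff_isSheaf_of_type _ _).2 ?_
    change Presieve.IsSheaf _ (idealTwistSubfunctor I F).toFunctor
    refine ((idealTwistSubfunctor I F).isSheaf_iff ?_).2 ?_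
    · exact (isSheaf_iff_isSheaf_of_type _ _).1
        ((TopCat.Presheaf.isSheaf_iff_isSheaf_comp (forget AddCommGrpCat) _).1 F.isSheaf)
    · intro U s hs
      refine mem_idealTwistSections_of_local fun x hx ↦ ?_
      obtain ⟨V, f, hf, hxV⟩ := hs x hx
      exact ⟨V, f.le, hxV, hf⟩

variable {I F}

lemma smul_mem_idealTwistSections {U : X.Opens} (e : Γ(F, U)) {f : Γ(X, U)} (hf : LocallyMem I f) :
    f • e ∈ idealTwistSections I F U := by
  intro V h e' he' f' hf'
  obtain ⟨a, ha⟩ := he'.bijective.2 (F.presheaf.map (homOfLE h).op e)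
  dsimp only at ha
  have : f' = X.presheaf.map (homOfLE h).op f * a := he'.bijective.1 (by
    change f' • e' = (_ * a) • e'
    rw [mul_smul, ha, hf', Scheme.Modules.map_smul])
  rw [this]
  exact (idealSections I V).mul_mem_right _ (hf.res I h)

/-- A single generator suffices for the test: any other generator changes the coefficient by a
regular factor, which preserves the ideal. -/
lemma mem_idealTwistSections_of_generator {U : X.Opens} {e : Γ(F, U)} (he : IsGenerator e)
    {f : Γ(X, U)} : f • e ∈ idealTwistSections I F U ↔ LocallyMem I f :=
  ⟨fun h ↦ h U le_rfl e he f (modules_map_self F _).symm, smul_mem_idealTwistSections e⟩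

/-- The multiplication `F ⊗ I → I F` on sections. -/
def idealTwistMul (U : X.Opens) :
    Γ(F, U) →ₗ[Γ(X, U)] Γ(idealModule I, U) →ₗ[Γ(X, U)] Γ(idealTwist I F, U) :=
  LinearMap.mk₂ (M := Γ(F, U)) (Nₗ := idealSections I U) (Pₗ := idealTwistSections I F U) Γ(X, U)
    (fun e f ↦ ⟨f.1 • e, smul_mem_idealTwistSections e f.2⟩)
    (fun _ _ _ ↦ Subtype.ext (smul_add _ _ _))
    (fun _ _ _ ↦ Subtype.ext (smul_comm _ _ _))
    (fun _ _ _ ↦ Subtype.ext (add_smul _ _ _))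
    (fun _ _ _ ↦ Subtype.ext (mul_smul _ _ _))

/-- If `F` is locally free of rank one, then `F ⊗ I` is the subsheaf `I F` of `F`. -/
def sheafTensorIdealIso (hF : ∀ x : X, ∃ (U : X.Opens) (e : Γ(F, U)), x ∈ U ∧ IsGenerator e) :
    sheafTensor F (idealModule I) ≅ idealTwist I F :=
  sheafTensorIso (idealTwistMul (I := I) (F := F))
    (fun U V i a b ↦ Subtype.ext (Scheme.Modules.map_smul F i b.1 a))
    (by
      intro x
      obtain ⟨U, e, hxU, he⟩ := hF x
      refine ⟨U, hxU, fun V hV ↦ ?_⟩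
      have he' := he.res hV
      refine lift_bijective_of_generator _ (F.presheaf.map (homOfLE hV).op e) he'.bijective.2
        ⟨?_, ?_⟩
      · intro a b hab
        exact Subtype.ext (he'.bijective.1 (congrArg Subtype.val hab))
      · intro s
        obtain ⟨f, hf⟩ := he'.bijective.2 s.1
        refine ⟨⟨f, ?_⟩, Subtype.ext hf⟩
        refine (mem_idealTwistSections_of_generator he').1 ?_
        dsimp only at hf
        rw [hf]
        exact s.2)

/-- Writing `b = f • e'` gives `μ(e, b) = f • μ(e, e')`, so `μ(e, ·)` matches two free modules of
rank one generator to generator. -/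
lemma lift_bijective_of_isGenerator {G H : X.Modules}
    (μ : ∀ U : X.Opens, Γ(F, U) →ₗ[Γ(X, U)] Γ(G, U) →ₗ[Γ(X, U)] Γ(H, U))
    (hμ : ∀ (U V : X.Opens) (i : V ⟶ U) (a : Γ(F, U)) (b : Γ(G, U)),
      H.presheaf.map i.op (μ U a b) = μ V (F.presheaf.map i.op a) (G.presheaf.map i.op b))
    {U : X.Opens} {e : Γ(F, U)} (he : IsGenerator e) {e' : Γ(G, U)} (he' : IsGenerator e')
    (hee' : IsGenerator (μ U e e')) {V : X.Opens} (hV : V ≤ U) :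
    Function.Bijective (TensorProduct.lift (μ V)) := by
  refine lift_bijective_of_generator _ (F.presheaf.map (homOfLE hV).op e) (he.res hV).bijective.2 ?_
  have h1 := (he'.res hV).bijective
  have h2 := (hee'.res hV).bijective
  rw [hμ] at h2
  refine (Function.Bijective.of_comp_iff _ h1).1 ?_
  convert h2 using 2 with f
  simp

end BetaConst

end

/-! ### The sheaves `𝒪(d)` on `Proj`: generators, multiplication, tensor powers -/

noncomputable section

namespace BetaConst

open Scheme.Modules

section Twist

variable {σ : Type*} {A : Type u} [CommRing A] [SetLike σ A] [AddSubgroupClass σ A]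
variable {𝒜 : ℕ → σ} [GradedRing 𝒜] {d e : ℕ}

variable (𝒜) in
/-- The degree `0` part of the local ring of `A` at a homogeneous prime ideal. -/
abbrev HLocAt (x : ProjectiveSpectrum 𝒜) : Type u :=
  HomogeneousLocalization.AtPrime 𝒜 x.asHomogeneousIdeal.toIdeal

/-- The value of a section of `𝒪(d)` at a point. -/
def twistVal {U : (Proj 𝒜).Opens} (s : Γ(twist 𝒜 d, U)) (x : U) : LocAt 𝒜 x.1 :=
  (show twistSections 𝒜 d U from s).1 x

/-- The value of a regular function at a point, in the local ring of `A`. -/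
def regularVal {U : (Proj 𝒜).Opens} (f : Γ(Proj 𝒜, U)) (x : U) : LocAt 𝒜 x.1 :=
  ((show (ProjectiveSpectrum.Proj.structureSheaf 𝒜).1.obj (op U) from f).1 x).val

lemma twist_ext {U : (Proj 𝒜).Opens} {s t : Γ(twist 𝒜 d, U)}
    (h : ∀ x, twistVal s x = twistVal t x) : s = t :=
  Subtype.ext (funext h)

lemma regular_ext {U : (Proj 𝒜).Opens} {s t : Γ(Proj 𝒜, U)}
    (h : ∀ x, regularVal s x = regularVal t x) : s = t :=
  Subtype.ext (funext fun x ↦ HomogeneousLocalization.val_injective _ (h x))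

lemma twistVal_smul {U : (Proj 𝒜).Opens} (f : Γ(Proj 𝒜, U)) (s : Γ(twist 𝒜 d, U)) (x : U) :
    twistVal (f • s) x = regularVal f x * twistVal s x := rfl

lemma twistVal_res {U V : (Proj 𝒜).Opens} (i : V ⟶ U) (s : Γ(twist 𝒜 d, U)) (x : V) :
    twistVal ((twist 𝒜 d).presheaf.map i.op s) x = twistVal s ⟨x.1, i.le x.2⟩ := rfl

lemma regularVal_mul {U : (Proj 𝒜).Opens} (f g : Γ(Proj 𝒜, U)) (x : U) :
    regularVal (f * g) x = regularVal f x * regularVal g x :=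
  HomogeneousLocalization.val_mul _ _

lemma regularVal_one {U : (Proj 𝒜).Opens} (x : U) : regularVal (1 : Γ(Proj 𝒜, U)) x = 1 :=
  HomogeneousLocalization.val_one

lemma exists_twistVal_eq {U : (Proj 𝒜).Opens} (s : Γ(twist 𝒜 d, U)) (x : U) :
    ∃ (V : (Proj 𝒜).Opens) (_ : x.1 ∈ V) (h : V ≤ U) (j : ℕ) (a : 𝒜 (j + d)) (b : 𝒜 j)
      (hb : ∀ y : V, b.1 ∉ y.1.asHomogeneousIdeal),
      ∀ y : V, twistVal s ⟨y.1, h y.2⟩ = Localization.mk a.1 ⟨b.1, hb y⟩ := by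
  obtain ⟨V, hxV, i, j, a, b, hb, h⟩ := s.2 x
  exact ⟨V, hxV, i.le, j, a, b, hb, h⟩

variable (𝒜) in
/-- The section of `𝒪(d)` given by a homogeneous element of degree `d`. -/
def twistOf (U : (Proj 𝒜).Opens) (a : 𝒜 d) : Γ(twist 𝒜 d, U) :=
  show twistSections 𝒜 d U from ⟨fun _ ↦ algebraMap A _ a.1, fun x ↦ ⟨U, x.2, 𝟙 _, 0,
    ⟨a.1, by simp⟩, ⟨1, SetLike.one_mem_graded _⟩,
    fun y ↦ (Ideal.ne_top_iff_one _).1 y.1.isPrime.ne_top,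
    fun _ ↦ (Localization.mk_one_eq_algebraMap _).symm⟩⟩

lemma twistVal_twistOf {U : (Proj 𝒜).Opens} (a : 𝒜 d) (x : U) :
    twistVal (twistOf 𝒜 U a) x = algebraMap A _ a.1 := rfl

lemma twistOf_res {U V : (Proj 𝒜).Opens} (i : V ⟶ U) (a : 𝒜 d) :
    (twist 𝒜 d).presheaf.map i.op (twistOf 𝒜 U a) = twistOf 𝒜 V a := rfl

lemma isUnit_algebraMap_locAt {x : ProjectiveSpectrum 𝒜} {a : A} (ha : a ∉ x.asHomogeneousIdeal) :
    IsUnit (algebraMap A (LocAt 𝒜 x) a) :=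
  IsLocalization.map_units (M := x.asHomogeneousIdeal.toIdeal.primeCompl) _ ⟨a, ha⟩

lemma mul_notMem {x : ProjectiveSpectrum 𝒜} {a b : A} (ha : a ∉ x.asHomogeneousIdeal)
    (hb : b ∉ x.asHomogeneousIdeal) : a * b ∉ x.asHomogeneousIdeal :=
  fun h ↦ (x.isPrime.mem_or_mem h).elim ha hb

/-- Dividing `s = p / q` by `a` gives `p / (q a)`, of degree `0`, with a denominator that vanishes
nowhere because `a` does not on `U`. The quotient is chosen pointwise and is then locally a
fraction, since `a` is a unit in each local ring and so determines it. -/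
lemma exists_smul_twistOf_eq {U : (Proj 𝒜).Opens} (a : 𝒜 d)
    (hU : U ≤ Proj.basicOpen 𝒜 a.1) (s : Γ(twist 𝒜 d, U)) :
    ∃ f : Γ(Proj 𝒜, U), f • twistOf 𝒜 U a = s := by
  have key : ∀ x : U, ∃ z : HLocAt 𝒜 x.1,
      z.val * algebraMap A (LocAt 𝒜 x.1) a.1 = twistVal s x := by
    intro x
    obtain ⟨V, hxV, hVU, j, p, q, hq, h⟩ := exists_twistVal_eq s x
    have hx : x.1 ∈ Proj.basicOpen 𝒜 a.1 := hU x.2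
    refine ⟨.mk ⟨j + d, p, ⟨q.1 * a.1, SetLike.mul_mem_graded q.2 a.2⟩,
      mul_notMem (hq ⟨x.1, hxV⟩) hx⟩, ?_⟩
    rw [h ⟨x.1, hxV⟩, HomogeneousLocalization.val_mk, ← Localization.mk_one_eq_algebraMap,
      Localization.mk_mul, Localization.mk_eq_mk_iff, Localization.r_iff_exists]
    exact ⟨1, by simp; ring⟩
  choose z hz using key
  have hf : (ProjectiveSpectrum.StructureSheaf.isLocallyFraction 𝒜).pred z := by
    intro x
    obtain ⟨V, hxV, hVU, j, p, q, hq, h⟩ := exists_twistVal_eq s x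
    have hx (y : V) : q.1 * a.1 ∉ y.1.asHomogeneousIdeal :=
      mul_notMem (hq y) (hU (hVU y.2))
    refine ⟨V, hxV, homOfLE hVU, j + d, p, ⟨q.1 * a.1, SetLike.mul_mem_graded q.2 a.2⟩, hx,
      fun y ↦ HomogeneousLocalization.val_injective _ ?_⟩
    have hy : y.1 ∈ Proj.basicOpen 𝒜 a.1 := hU (hVU y.2)
    refine (isUnit_algebraMap_locAt hy).mul_left_injective ?_
    refine (hz ⟨y.1, hVU y.2⟩).trans ?_
    rw [h y]
    dsimp only
    rw [HomogeneousLocalization.val_mk, ← Localization.mk_one_eq_algebraMap,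
      Localization.mk_mul, Localization.mk_eq_mk_iff, Localization.r_iff_exists]
    exact ⟨1, by simp; ring⟩
  exact ⟨(show (ProjectiveSpectrum.Proj.structureSheaf 𝒜).1.obj (op U) from ⟨z, hf⟩),
    twist_ext hz⟩

lemma isGenerator_twistOf {U : (Proj 𝒜).Opens} (a : 𝒜 d)
    (hU : U ≤ Proj.basicOpen 𝒜 a.1) : IsGenerator (twistOf 𝒜 U a) := by
  intro V hV
  refine ⟨fun f g h ↦ regular_ext fun x ↦ ?_, exists_smul_twistOf_eq a (hV.trans hU)⟩
  exact (isUnit_algebraMap_locAt (hU (hV x.2))).mul_left_injective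
    (congrArg (twistVal · x) h)

/-- Multiplication of sections of `𝒪(d)` and `𝒪(e)`. -/
def twistMul (U : (Proj 𝒜).Opens) :
    Γ(twist 𝒜 d, U) →ₗ[Γ(Proj 𝒜, U)] Γ(twist 𝒜 e, U) →ₗ[Γ(Proj 𝒜, U)] Γ(twist 𝒜 (d + e), U) :=
  LinearMap.mk₂ Γ(Proj 𝒜, U)
    (fun s t ↦ show twistSections 𝒜 (d + e) U from ⟨fun x ↦ twistVal s x * twistVal t x, by
      intro x
      obtain ⟨V, hxV, hVU, j, p, q, hq, h⟩ := exists_twistVal_eq s x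
      obtain ⟨V', hxV', hVU', j', p', q', hq', h'⟩ := exists_twistVal_eq t x
      refine ⟨V ⊓ V', ⟨hxV, hxV'⟩, homOfLE (inf_le_left.trans hVU), j + j',
        ⟨p.1 * p'.1, ?_⟩, ⟨q.1 * q'.1, SetLike.mul_mem_graded q.2 q'.2⟩,
        fun y ↦ mul_notMem
          (hq ⟨y.1, y.2.1⟩) (hq' ⟨y.1, y.2.2⟩), fun y ↦ ?_⟩
      · rw [show j + j' + (d + e) = j + d + (j' + e) by omega]
        exact SetLike.mul_mem_graded p.2 p'.2
      · refine (congrArg₂ (· * ·) (h ⟨y.1, y.2.1⟩) (h' ⟨y.1, y.2.2⟩)).trans ?_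
        exact Localization.mk_mul _ _ _ _⟩)
    (fun _ _ _ ↦ twist_ext fun _ ↦ add_mul _ _ _)
    (fun _ _ _ ↦ twist_ext fun _ ↦ mul_assoc _ _ _)
    (fun _ _ _ ↦ twist_ext fun _ ↦ mul_add _ _ _)
    (fun _ _ _ ↦ twist_ext fun _ ↦ mul_left_comm _ _ _)

lemma twistMul_twistOf (U : (Proj 𝒜).Opens) (a : 𝒜 d) (b : 𝒜 e) :
    twistMul U (twistOf 𝒜 U a) (twistOf 𝒜 U b) =
      twistOf 𝒜 U ⟨a.1 * b.1, SetLike.mul_mem_graded a.2 b.2⟩ :=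
  twist_ext fun _ ↦ (map_mul _ _ _).symm

variable (𝒜) in
/-- `𝒪(d) ⊗ 𝒪(e) ≅ 𝒪(d + e)`, if the sets `D₊(a b)`, with `a` of degree `d` and `b` of degree
`e`, cover `Proj A`. -/
def sheafTensorTwistIso (d e : ℕ)
    (h : ∀ x : Proj 𝒜, ∃ (a : 𝒜 d) (b : 𝒜 e), x ∈ Proj.basicOpen 𝒜 (a.1 * b.1)) :
    sheafTensor (twist 𝒜 d) (twist 𝒜 e) ≅ twist 𝒜 (d + e) :=
  sheafTensorIso twistMul (fun _ _ _ _ _ ↦ rfl) (by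
    intro x
    obtain ⟨a, b, hab⟩ := h x
    refine ⟨_, hab, fun V hV ↦ lift_bijective_of_isGenerator _ (fun _ _ _ _ _ ↦ rfl)
      (isGenerator_twistOf a ?_) (isGenerator_twistOf b ?_) ?_ hV⟩
    · exact Proj.basicOpen_mono _ _ _ ⟨_, rfl⟩
    · exact Proj.basicOpen_mono _ _ _ ⟨_, mul_comm _ _⟩
    · rw [twistMul_twistOf]
      exact isGenerator_twistOf _ le_rfl)

lemma isGenerator_one (X : Scheme.{u}) (U : X.Opens) :
    IsGenerator (F := structureModule X) (U := U) (1 : Γ(X, U)) := by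
  intro V h
  refine Function.bijective_iff_has_inverse.2 ⟨id, fun f ↦ ?_, fun f ↦ ?_⟩
  · exact (congrArg (fun g : Γ(X, V) ↦ (show Γ(X, V) from f) * g)
      (map_one (X.presheaf.map (homOfLE h).op).hom)).trans (mul_one (M := Γ(X, V)) f)
  · exact (congrArg (fun g : Γ(X, V) ↦ (show Γ(X, V) from f) * g)
      (map_one (X.presheaf.map (homOfLE h).op).hom)).trans (mul_one (M := Γ(X, V)) f)

/-- `𝒪 ⊗ F ≅ F`. -/
def sheafTensorUnitIso {X : Scheme.{u}} (F : X.Modules) : sheafTensor (structureModule X) F ≅ F :=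
  sheafTensorIso (F := structureModule X)
    (fun U ↦ LinearMap.mk₂ (M := Γ(X, U)) Γ(X, U) (fun f s ↦ f • s) (fun _ _ _ ↦ add_smul _ _ _)
      (fun _ _ _ ↦ mul_smul _ _ _) (fun _ _ _ ↦ smul_add _ _ _) (fun _ _ _ ↦ smul_comm _ _ _))
    (fun _ _ i f s ↦ Scheme.Modules.map_smul F i f s)
    (fun x ↦ ⟨⊤, trivial, fun V _ ↦ lift_bijective_of_generator _ (1 : Γ(X, V))
      (isGenerator_one X V).bijective.2 (by
        convert! Function.bijective_id using 1
        funext s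
        exact one_smul _ s)⟩)

variable (𝒜) in
/-- `𝒪(1)^N ≅ 𝒪(N)`, if the irrelevant locus of the elements of degree `1` is empty. -/
theorem nonempty_tensorPow_iso (h : ∀ x : Proj 𝒜, ∃ a : 𝒜 1, x ∈ Proj.basicOpen 𝒜 a.1) (N : ℕ) :
    Nonempty (tensorPow (twist 𝒜 1) (N + 1) ≅ twist 𝒜 (N + 1)) := by
  induction N with
  -- The first tensor power unfolds to `𝒪 ⊗ 𝒪(1)`.
  | zero => exact ⟨sheafTensorUnitIso _⟩
  | succ N ih =>
    obtain ⟨i⟩ := ih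
    refine ⟨sheafTensorCongr i (Iso.refl _) ≪≫ sheafTensorTwistIso 𝒜 (N + 1) 1 fun x ↦ ?_⟩
    obtain ⟨a, ha⟩ := h x
    -- The cover by the sets `D₊(a)` also serves here, as `D₊(a ^ (N + 1) * a) = D₊(a)`.
    refine ⟨⟨a.1 ^ (N + 1), by simpa using SetLike.pow_mem_graded (N + 1) a.2⟩, a, ?_⟩
    rw [← pow_succ, Proj.basicOpen_pow _ _ _ (by omega)]
    exact ha

end Twist

end BetaConst

end

/-! ### Constants, charts and global sections of `𝒪(N)` on projective space -/

noncomputable section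

namespace BetaConst

open Scheme.Modules MvPolynomial

attribute [local instance] MvPolynomial.gradedAlgebra

section Val
variable {σ : Type*} {A : Type u} [CommRing A] [SetLike σ A] [AddSubgroupClass σ A]
variable {𝒜 : ℕ → σ} [GradedRing 𝒜] {d : ℕ}

/-- Evaluation of regular functions at a point, as a ring homomorphism. -/
def regularValHom {U : (Proj 𝒜).Opens} (x : U) : Γ(Proj 𝒜, U) →+* LocAt 𝒜 x.1 where
  toFun f := regularVal f x
  map_one' := regularVal_one x
  map_mul' f g := regularVal_mul f g x
  map_zero' := HomogeneousLocalization.val_zero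
  map_add' _ _ := HomogeneousLocalization.val_add _ _

lemma regularValHom_apply {U : (Proj 𝒜).Opens} (x : U) (f : Γ(Proj 𝒜, U)) :
    regularValHom x f = regularVal f x := rfl

lemma regularVal_awayToSection (g : A) (z : HomogeneousLocalization.Away 𝒜 g)
    (x : Proj.basicOpen 𝒜 g) : regularVal (Proj.awayToSection 𝒜 g z) x =
      IsLocalization.map (M := Submonoid.powers g)
        (T := (show ProjectiveSpectrum 𝒜 from x.1).asHomogeneousIdeal.toIdeal.primeCompl)
        (LocAt 𝒜 x.1)
        (RingHom.id _) (Submonoid.powers_le.mpr x.2) z.val :=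
  ProjectiveSpectrum.Proj.awayToSection_apply 𝒜 g z x

lemma regularVal_awayToSection_mk {g : A} (hg : g ∈ 𝒜 d) (t : ℕ) (a : A) (ha : a ∈ 𝒜 (t • d))
    (x : Proj.basicOpen 𝒜 g) :
    regularVal (Proj.awayToSection 𝒜 g (HomogeneousLocalization.Away.mk 𝒜 hg t a ha)) x *
      algebraMap A _ g ^ t = algebraMap A _ a := by
  rw [regularVal_awayToSection, HomogeneousLocalization.Away.val_mk, Localization.mk_eq_mk',
    IsLocalization.map_mk', ← map_pow]
  exact IsLocalization.mk'_spec _ _ _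

-- The map to `Spec 𝒜₀` is built through the chart `D₊(1)`, which is all of `Proj`; its pullback is
-- computed there.
variable (𝒜) in
lemma toSpecZero_appTop : (Scheme.ΓSpecIso (.of (𝒜 0))).inv ≫ (Proj.toSpecZero 𝒜).appTop =
    CommRingCat.ofHom (HomogeneousLocalization.fromZeroRingHom 𝒜 (Submonoid.powers 1)) ≫
      Proj.awayToSection 𝒜 1 ≫ (Proj 𝒜).presheaf.map (eqToHom (by simp)).op := by
  rw [Proj.toSpecZero]
  simp only [Scheme.Hom.comp_appTop, Category.assoc]
  rw [← Scheme.ΓSpecIso_inv_naturality_assoc]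
  congr 1
  have := Proj.basicOpenToSpec_app_top 𝒜 (1 : A)
  rw [← Scheme.Hom.appTop] at this
  rw [this]
  simp only [← Category.assoc]
  erw [Iso.inv_hom_id]
  simp only [Category.assoc]
  erw [Category.id_comp]
  congr 1
  have key : ∀ (U : (Proj 𝒜).Opens) (h : U = ⊤),
      U.topIso.inv ≫ ((Proj 𝒜).isoOfEq h).inv.appTop ≫ (Proj 𝒜).topIso.inv.appTop =
        (Proj 𝒜).presheaf.map (eqToHom (by rw [h])).op := by
    rintro U rfl
    simp
    have h := congr(($((Proj 𝒜).toIso_inv_ι)).appTop)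
    rw [Scheme.Hom.comp_appTop, Scheme.Opens.ι_appTop] at h
    exact h
  exact key _ _

lemma regularVal_toSpecZero (a : 𝒜 0) (x : Proj 𝒜) :
    regularVal (U := ⊤) (((Scheme.ΓSpecIso (.of (𝒜 0))).inv ≫ (Proj.toSpecZero 𝒜).appTop) a)
      ⟨x, trivial⟩ = algebraMap A _ a.1 := by
  rw [toSpecZero_appTop]
  refine (regularVal_awayToSection (1 : A) (HomogeneousLocalization.fromZeroRingHom 𝒜 _ a)
    ⟨x, by simp⟩).trans ?_
  refine (congrArg _ (HomogeneousLocalization.val_mk _)).trans ?_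
  rw [Localization.mk_eq_mk', IsLocalization.map_mk']
  exact IsLocalization.mk'_one _ _
end Val

variable {n : ℕ} {k : Type u} [Field k]

/-- Links the action of `k` in `h0` with scalar multiplication of polynomials; the linearity of the
identifications of global sections rests on it. -/
lemma regularVal_toSpec (a : k) (x : PSpace n k) :
    regularVal (U := ⊤) (((Scheme.ΓSpecIso (.of k)).inv ≫ (PSpace.toSpec n k).appTop) a)
      ⟨x, trivial⟩ = algebraMap (MvPolynomial (Fin (n + 1)) k) _ (C a) := by
  refine Eq.trans ?_ (regularVal_toSpecZero
    (algebraMap k (homogeneousSubmodule (Fin (n + 1)) k 0) a) x)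
  congr 1
  rw [PSpace.toSpec, Scheme.Hom.comp_appTop]
  rw [← Scheme.ΓSpecIso_inv_naturality_assoc]
  rfl

lemma IsHomogeneous.of_X_pow_mul {ι : Type*} {i : ι} {t N : ℕ} {p : MvPolynomial ι k}
    (h : (X i ^ t * p).IsHomogeneous (t + N)) : p.IsHomogeneous N := by
  intro c hc
  have h1 : coeff (Finsupp.single i t + c) (X i ^ t * p) ≠ 0 := by
    rw [X_pow_eq_monomial, coeff_monomial_mul, one_mul]
    exact hc
  have := h h1
  rw [map_add] at this
  simp only [Finsupp.weight_single, Pi.one_apply, smul_eq_mul, mul_one] at this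
  omega

variable (n k) in
/-- The generic point of projective space. -/
def genericPt : PSpace n k :=
  ⟨⊥, (Ideal.isPrime_bot : (⊥ : Ideal (MvPolynomial (Fin (n + 1)) k)).IsPrime), fun h ↦ by
    have h1 : (X 0 : MvPolynomial (Fin (n + 1)) k) ∈
        HomogeneousIdeal.irrelevant (homogeneousSubmodule (Fin (n + 1)) k) := by
      rw [HomogeneousIdeal.mem_irrelevant_iff]
      exact DirectSum.decompose_of_mem_ne _ (X_mem (k := k) 0) one_ne_zero
    exact X_ne_zero (R := k) 0 ((Submodule.mem_bot _).1 (h h1))⟩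

lemma genericPt_mem_chart (j : Fin (n + 1)) : genericPt n k ∈ (PSpace.chart (k := k) j).1 :=
  fun h ↦ X_ne_zero (R := k) j ((Submodule.mem_bot (R := MvPolynomial (Fin (n + 1)) k)).1 h)

/-- The map from the homogeneous coordinate ring to its local ring at a point. -/
abbrev toLoc (x : PSpace n k) :
    MvPolynomial (Fin (n + 1)) k →+* LocAt (homogeneousSubmodule (Fin (n + 1)) k) x :=
  algebraMap _ _

lemma toLoc_injective (x : PSpace n k) : Function.Injective (toLoc x) :=
  IsLocalization.injective (M := (show ProjectiveSpectrum (homogeneousSubmodule (Fin (n + 1)) k)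
    from x).asHomogeneousIdeal.toIdeal.primeCompl) _ (Ideal.primeCompl_le_nonZeroDivisors _)

lemma irrelevant_le_span_X : (HomogeneousIdeal.irrelevant
    (homogeneousSubmodule (Fin (n + 1)) k)).toIdeal ≤
      Ideal.span (Set.range (X : Fin (n + 1) → MvPolynomial (Fin (n + 1)) k)) := by
  intro p hp
  rw [← Set.image_univ, mem_ideal_span_X_image]
  intro m hm
  by_contra! h
  have hm0 : m = 0 := Finsupp.ext fun i ↦ h i trivial
  subst hm0
  have h0 : homogeneousComponent 0 p = 0 := by
    have := (HomogeneousIdeal.mem_irrelevant_iff _ _).1 hp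
    rwa [GradedRing.proj_apply, ← DirectSum.Decomposition.decompose'_eq,
      decomposition.decompose'_apply] at this
  rw [homogeneousComponent_zero, map_eq_zero_iff _ (C_injective _ _)] at h0
  exact mem_support_iff.1 hm h0

lemma exists_mem_chart (x : PSpace n k) : ∃ j, x ∈ (PSpace.chart (k := k) j).1 := by
  refine (Opens.mem_iSup (s := fun j ↦ (PSpace.chart (k := k) j).1)).1 ?_
  exact (Proj.iSup_basicOpen_eq_top (homogeneousSubmodule (Fin (n + 1)) k) X
    irrelevant_le_span_X).ge (Opens.mem_top x)

/-- The power `x_j ^ N` as an element of degree `N`. -/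
def XPow (j : Fin (n + 1)) (N : ℕ) : homogeneousSubmodule (Fin (n + 1)) k N :=
  ⟨X j ^ N, isHomogeneous_X_pow j N⟩

lemma isGenerator_XPow (j : Fin (n + 1)) (N : ℕ) :
    IsGenerator (twistOf (homogeneousSubmodule (Fin (n + 1)) k) (PSpace.chart j).1 (XPow j N)) :=
  isGenerator_twistOf _ (by
    -- For `N = 0` the element is `1`, whose basic open set is everything rather than `D₊(x_j)`.
    rcases Nat.eq_zero_or_pos N with rfl | hN
    · intro x _
      simp [XPow]
    · exact (Proj.basicOpen_pow _ _ _ hN).ge)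

/-- The regular function `p / x_j ^ t` on `D₊(x_j)`. -/
def frac (j : Fin (n + 1)) {t : ℕ} (p : homogeneousSubmodule (Fin (n + 1)) k t) :
    Γ(PSpace n k, (PSpace.chart j).1) :=
  (Proj.awayToSection (homogeneousSubmodule (Fin (n + 1)) k) (X j)).hom
    (HomogeneousLocalization.Away.mk _ (X_mem j) t p.1 (by rw [smul_eq_mul, mul_one]; exact p.2))

lemma regularVal_frac (j : Fin (n + 1)) {t : ℕ} (p : homogeneousSubmodule (Fin (n + 1)) k t)
    (x : (PSpace.chart (k := k) j).1) :
    regularVal (frac j p) x * toLoc x.1 (X j ^ t) = toLoc x.1 p.1 := by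
  rw [map_pow]
  exact regularVal_awayToSection_mk _ _ _ _ _

lemma exists_eq_frac (j : Fin (n + 1)) (f : Γ(PSpace n k, (PSpace.chart j).1)) :
    ∃ (t : ℕ) (p : homogeneousSubmodule (Fin (n + 1)) k t), f = frac j p := by
  have hi := (ConcreteCategory.bijective_of_isIso (Proj.basicOpenIsoAway
    (homogeneousSubmodule (Fin (n + 1)) k) (X j) (X_mem j) one_pos).hom).2 f
  rw [Proj.basicOpenIsoAway_hom] at hi
  obtain ⟨z, rfl⟩ := hi
  obtain ⟨t, a, ha, rfl⟩ := HomogeneousLocalization.Away.mk_surjective _ (X_mem j) z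
  exact ⟨t, ⟨a, by rwa [smul_eq_mul, mul_one] at ha⟩, rfl⟩

/-- On the chart `D₊(x_j)`, a section of `𝒪(N)` is a fraction. -/
lemma exists_twistVal_mul_eq {N : ℕ} {U : (PSpace n k).Opens} (j : Fin (n + 1))
    (hU : (PSpace.chart j).1 ≤ U)
    (s : Γ(twist (homogeneousSubmodule (Fin (n + 1)) k) N, U)) :
    ∃ (t : ℕ) (p : homogeneousSubmodule (Fin (n + 1)) k (t + N)),
      ∀ x : (PSpace.chart (k := k) j).1,
        toLoc x.1 (X j ^ t) * twistVal s ⟨x.1, hU x.2⟩ = toLoc x.1 p.1 := by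
  obtain ⟨f, hf⟩ := (isGenerator_XPow j N).bijective.2
    ((twist (homogeneousSubmodule (Fin (n + 1)) k) N).presheaf.map (homOfLE hU).op s)
  obtain ⟨t, p, rfl⟩ := exists_eq_frac j f
  refine ⟨t, ⟨p.1 * X j ^ N, SetLike.mul_mem_graded p.2 (XPow j N).2⟩, fun x ↦ ?_⟩
  have h1 := congrArg (twistVal · x) hf
  dsimp only at h1
  rw [twistVal_res, twistVal_smul, twistVal_twistOf] at h1
  rw [← h1, map_mul, ← regularVal_frac j p x]
  simp only [XPow]
  ring

/-- The global sections of `𝒪(N)` on `ℙⁿ`, `n > 0`, are the homogeneous polynomials of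
degree `N`. -/
theorem twistOf_surjective (hn : 0 < n) {N : ℕ}
    (s : Γ(twist (homogeneousSubmodule (Fin (n + 1)) k) N, ⊤)) :
    ∃ p : homogeneousSubmodule (Fin (n + 1)) k N, twistOf _ ⊤ p = s := by
  obtain ⟨t, p, hp⟩ := exists_twistVal_mul_eq 0 le_top s
  let η := genericPt n k
  have inj := toLoc_injective η
  -- The section is `p / x_0 ^ t` on one chart and `q / x_1 ^ u` on another; `n > 0` supplies `x_1`.
  -- Comparing at the generic point gives `x_0 ^ t q = x_1 ^ u p`, and `x_0` is a prime not dividing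
  -- `x_1`.
  obtain ⟨q, hq⟩ : X 0 ^ t ∣ p.1 := by
    obtain ⟨u, q, hq⟩ := exists_twistVal_mul_eq ⟨1, by omega⟩ le_top s
    have h1 := hp ⟨η, genericPt_mem_chart _⟩
    have h2 := hq ⟨η, genericPt_mem_chart _⟩
    have h3 : X 0 ^ t * q.1 = X ⟨1, by omega⟩ ^ u * p.1 := inj (by
      rw [map_mul, map_mul, ← h1, ← h2]
      ring)
    have h4 : X (0 : Fin (n + 1)) ^ t ∣ X (⟨1, by omega⟩ : Fin (n + 1)) ^ u * p.1 := ⟨_, h3.symm⟩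
    refine (X_prime (R := k) (i := (0 : Fin (n + 1)))).pow_dvd_of_dvd_mul_left t (fun h ↦ ?_) h4
    have := (X_prime (R := k) (i := (0 : Fin (n + 1)))).dvd_of_dvd_pow h
    rw [X_dvd_X] at this
    simp at this
  have hq' : q.IsHomogeneous N := IsHomogeneous.of_X_pow_mul (i := 0) (t := t) (by
    rw [← hq]; exact p.2)
  refine ⟨⟨q, hq'⟩, twist_ext fun x ↦ ?_⟩
  obtain ⟨j, hj⟩ := exists_mem_chart x.1
  obtain ⟨u, r, hr⟩ := exists_twistVal_mul_eq j le_top s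
  have h1 := hp ⟨η, genericPt_mem_chart _⟩
  have h2 := hr ⟨η, genericPt_mem_chart _⟩
  -- The generic point forces the numerator on the chart of `x` to be `x_j ^ u q`; the unit `x_j ^
  -- u` is then cancelled in the local ring at `x`.
  have h3 : r.1 = X j ^ u * q := by
    have h5 : X 0 ^ t * r.1 = X j ^ u * p.1 := inj (by
      rw [map_mul, map_mul, ← h1, ← h2]
      ring)
    rw [hq] at h5
    refine mul_left_cancel₀ (pow_ne_zero t (X_ne_zero (0 : Fin (n + 1)))) (h5.trans ?_)
    ring
  have h4 := hr ⟨x.1, hj⟩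
  rw [h3, map_mul] at h4
  refine (IsUnit.mul_right_injective ?_ h4).symm
  rw [map_pow]
  exact (isUnit_algebraMap_locAt hj).pow _

end BetaConst

end

/-! ### Global sections of `I^m 𝒪(N)` for a linear subscheme -/

noncomputable section

namespace BetaConst

open Scheme.Modules MvPolynomial

attribute [local instance] MvPolynomial.gradedAlgebra

/-- Over an affine open, the ideal is the kernel of restriction to the closed subscheme, and
vanishing of a section there is a local condition. -/
lemma mem_ideal_of_locallyMem {X : Scheme.{u}} {I : X.IdealSheafData} {U : X.affineOpens}
    {s : Γ(X, U.1)} (hs : LocallyMem I s) : s ∈ I.ideal U := by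
  rw [← I.ker_subschemeι_app U, RingHom.mem_ker]
  refine TopCat.Presheaf.section_ext I.subscheme.sheaf _ _ _ fun y hy ↦ ?_
  obtain ⟨V, h, hyV, hV⟩ := hs (I.subschemeι y) hy
  rw [← I.ker_subschemeι_app V, RingHom.mem_ker] at hV
  refine TopCat.Presheaf.germ_ext I.subscheme.presheaf (I.subschemeι ⁻¹ᵁ V.1) hyV
    (homOfLE (I.subschemeι.preimage_mono h)) (homOfLE (I.subschemeι.preimage_mono h)) ?_
  rw [map_zero]
  refine Eq.trans ?_ hV
  exact (congr($(I.subschemeι.naturality (homOfLE h).op) s)).symm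

lemma eval₂_mul_of_isHomogeneous {ι R S : Type*} [CommRing R] [CommRing S] (f : R →+* S)
    (g : ι → S) (c : S) {N : ℕ} {p : MvPolynomial ι R} (hp : p.IsHomogeneous N) :
    eval₂ f (fun i ↦ g i * c) p = eval₂ f g p * c ^ N := by
  rw [eval₂_eq, eval₂_eq, Finset.sum_mul]
  refine Finset.sum_congr rfl fun d hd ↦ ?_
  rw [mul_assoc]
  congr 1
  have : N = ∑ i ∈ d.support, d i := by
    have := hp (mem_support_iff.1 hd)
    rw [← this, Finsupp.weight_apply, Finsupp.sum]
    simp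
  rw [this, ← Finset.prod_pow_eq_pow_sum, ← Finset.prod_mul_distrib]
  simp [mul_pow]

variable {n : ℕ} {k : Type u} [Field k]

/-- Dehomogenization on the chart `D₊(x_j)`. -/
def dehomHom (j : Fin (n + 1)) :
    MvPolynomial (Fin (n + 1)) k →+* Γ(PSpace n k, (PSpace.chart j).1) :=
  eval₂Hom ((Scheme.ΓSpecIso (.of k)).inv ≫ (PSpace.toSpec n k).appTop ≫
    (PSpace n k).presheaf.map (homOfLE le_top).op).hom
    (fun i ↦ frac j ⟨X i, X_mem i⟩)

/-- Makes `p ↦ p / x_j ^ N` the restriction of one ring homomorphism for all `N`, so that taking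
powers of ideals commutes with passing to a chart. -/
lemma dehomHom_eq_frac (j : Fin (n + 1)) {N : ℕ}
    (p : homogeneousSubmodule (Fin (n + 1)) k N) : dehomHom j p.1 = frac j p := by
  refine regular_ext fun x ↦ ?_
  have hu : IsUnit (toLoc x.1 (X j ^ N)) := by
    rw [map_pow]
    exact (isUnit_algebraMap_locAt x.2).pow _
  refine hu.mul_left_injective ?_
  dsimp only
  rw [regularVal_frac, ← regularValHom_apply, dehomHom, coe_eval₂Hom, hom_eval₂, map_pow,
    ← eval₂_mul_of_isHomogeneous _ _ _ p.2]
  have h1 : (regularValHom x).comp ((Scheme.ΓSpecIso (.of k)).inv ≫ (PSpace.toSpec n k).appTop ≫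
    (PSpace n k).presheaf.map (homOfLE le_top).op).hom = (toLoc x.1).comp C := by
    ext a
    exact regularVal_toSpec a x.1
  have h2 : (fun i ↦ (regularValHom x ∘ fun i ↦ frac j ⟨X i, X_mem i⟩) i * toLoc x.1 (X j)) =
      fun i ↦ toLoc x.1 (X i) := by
    funext i
    refine Eq.trans ?_ (regularVal_frac j ⟨X i, X_mem i⟩ x)
    rw [pow_one]
    rfl
  refine (congrArg₂ (fun f g ↦ eval₂ f g p.1) h1 h2).trans ?_
  conv_rhs => rw [← eval₂_eta p.1, hom_eval₂]

/-- The ideal generated by a space of linear forms. -/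
def linearIdeal (W : Submodule k (homogeneousSubmodule (Fin (n + 1)) k 1)) :
    Ideal (MvPolynomial (Fin (n + 1)) k) :=
  Ideal.span (Subtype.val '' (W : Set (homogeneousSubmodule (Fin (n + 1)) k 1)))

variable {W : Submodule k (homogeneousSubmodule (Fin (n + 1)) k 1)}
  {I : (PSpace n k).IdealSheafData}

lemma map_dehomHom_linearIdeal (j : Fin (n + 1)) :
    (linearIdeal W).map (dehomHom j) = Ideal.span (PSpace.dehomogenize j '' (W : Set _)) := by
  rw [linearIdeal, Ideal.map_span, Set.image_image]
  congr 1
  exact Set.image_congr fun ℓ _ ↦ dehomHom_eq_frac j ℓ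

lemma twistOf_chart_eq {N : ℕ} (p : homogeneousSubmodule (Fin (n + 1)) k N) (j : Fin (n + 1)) :
    (frac j p) • twistOf (homogeneousSubmodule (Fin (n + 1)) k) (PSpace.chart j).1 (XPow j N) =
      twistOf (homogeneousSubmodule (Fin (n + 1)) k) (PSpace.chart j).1 p :=
  twist_ext fun x ↦ regularVal_frac j p x

lemma twistOf_mem_of_mem_pow
    (hI : ∀ j, I.ideal (PSpace.chart j) = Ideal.span (PSpace.dehomogenize j '' (W : Set _)))
    {N m : ℕ} {p : homogeneousSubmodule (Fin (n + 1)) k N} (hp : p.1 ∈ linearIdeal W ^ m) :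
    twistOf (homogeneousSubmodule (Fin (n + 1)) k) ⊤ p ∈
      idealTwistSections (I ^ m) (twist (homogeneousSubmodule (Fin (n + 1)) k) N) ⊤ := by
  refine mem_idealTwistSections_of_local fun x _ ↦ ?_
  obtain ⟨j, hj⟩ := exists_mem_chart x
  refine ⟨_, le_top, hj, ?_⟩
  rw [twistOf_res, ← twistOf_chart_eq, mem_idealTwistSections_of_generator (isGenerator_XPow j N)]
  refine fun y hy ↦ ⟨PSpace.chart j, le_rfl, hy, ?_⟩
  rw [show (homOfLE le_rfl : (PSpace.chart j).1 ⟶ (PSpace.chart (k := k) j).1).op = 𝟙 _ from rfl,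
    CategoryTheory.Functor.map_id, Scheme.IdealSheafData.ideal_pow, Pi.pow_apply, hI,
    ← map_dehomHom_linearIdeal, ← Ideal.map_pow, ← dehomHom_eq_frac]
  exact Ideal.mem_map_of_mem _ hp

/-- The regular functions on `D₊(x_j)` as elements of `k[x_0, …, x_n, x_j⁻¹]`. -/
def chartToAway (j : Fin (n + 1)) : Γ(PSpace n k, (PSpace.chart j).1) →+*
    Localization.Away (X j : MvPolynomial (Fin (n + 1)) k) :=
  (algebraMap (HomogeneousLocalization.Away (homogeneousSubmodule (Fin (n + 1)) k) (X j)) _).comp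
    (Proj.basicOpenIsoAway (homogeneousSubmodule (Fin (n + 1)) k) (X j) (X_mem j) one_pos).inv.hom

lemma chartToAway_frac (j : Fin (n + 1)) {N : ℕ} (p : homogeneousSubmodule (Fin (n + 1)) k N) :
    chartToAway j (frac j p) * algebraMap (MvPolynomial (Fin (n + 1)) k) _ (X j ^ N) =
      algebraMap (MvPolynomial (Fin (n + 1)) k) _ p.1 := by
  have h : frac j p = (Proj.basicOpenIsoAway (homogeneousSubmodule (Fin (n + 1)) k) (X j)
      (X_mem j) one_pos).hom (HomogeneousLocalization.Away.mk _ (X_mem j) N p.1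
        (by rw [smul_eq_mul, mul_one]; exact p.2)) := by
    rw [Proj.basicOpenIsoAway_hom]
    rfl
  rw [h]
  have h2 := congr($((Proj.basicOpenIsoAway (homogeneousSubmodule (Fin (n + 1)) k) (X j)
    (X_mem j) one_pos).hom_inv_id).hom (HomogeneousLocalization.Away.mk _ (X_mem j) N p.1
      (by rw [smul_eq_mul, mul_one]; exact p.2)))
  refine (congrArg (fun z ↦ algebraMap (HomogeneousLocalization.Away
    (homogeneousSubmodule (Fin (n + 1)) k) (X j))
    (Localization.Away (X j : MvPolynomial (Fin (n + 1)) k)) z * _) h2).trans ?_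
  rw [HomogeneousLocalization.algebraMap_apply, CommRingCat.hom_id, RingHom.id_apply,
    HomogeneousLocalization.Away.val_mk,
    Localization.mk_eq_mk']
  exact IsLocalization.mk'_spec _ _ _

/-- One chart is enough: `hj` says that `x_j` is a nonzerodivisor modulo the power of the ideal, so
nothing is lost by inverting it. -/
lemma mem_pow_of_twistOf_mem
    (hI : ∀ j, I.ideal (PSpace.chart j) = Ideal.span (PSpace.dehomogenize j '' (W : Set _)))
    {N m : ℕ} {p : homogeneousSubmodule (Fin (n + 1)) k N} (j : Fin (n + 1))
    (hj : ∀ q, X j * q ∈ linearIdeal W ^ m → q ∈ linearIdeal W ^ m)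
    (hp : twistOf (homogeneousSubmodule (Fin (n + 1)) k) ⊤ p ∈
      idealTwistSections (I ^ m) (twist (homogeneousSubmodule (Fin (n + 1)) k) N) ⊤) :
    p.1 ∈ linearIdeal W ^ m := by
  have h1 := res_mem_idealTwistSections (I ^ m) (le_top : (PSpace.chart j).1 ≤ ⊤) hp
  rw [twistOf_res, ← twistOf_chart_eq, mem_idealTwistSections_of_generator
    (isGenerator_XPow j N)] at h1
  have h2 := mem_ideal_of_locallyMem h1
  rw [Scheme.IdealSheafData.ideal_pow, Pi.pow_apply, hI] at h2
  -- In `k[x_0, …, x_n, x_j⁻¹]` the functions `ℓ / x_j` and `ℓ` differ by a unit.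
  have h3 : (Ideal.span (PSpace.dehomogenize j ''
      (W : Set (homogeneousSubmodule (Fin (n + 1)) k 1)))).map (chartToAway j) ≤
      (linearIdeal W).map (algebraMap _ _) := by
    rw [Ideal.map_span, Ideal.span_le]
    rintro _ ⟨_, ⟨ℓ, hℓ, rfl⟩, rfl⟩
    have h4 := chartToAway_frac j ℓ
    have hu : IsUnit (algebraMap (MvPolynomial (Fin (n + 1)) k)
        (Localization.Away (X j : MvPolynomial (Fin (n + 1)) k)) (X j ^ 1)) :=
      IsLocalization.map_units (M := Submonoid.powers (X j)) _ ⟨_, 1, rfl⟩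
    refine (Ideal.mul_unit_mem_iff_mem _ hu).1 ?_
    erw [h4]
    exact Ideal.mem_map_of_mem _ (Ideal.subset_span ⟨ℓ, hℓ, rfl⟩)
  have h4 := Ideal.mem_map_of_mem (chartToAway j) h2
  rw [Ideal.map_pow] at h4
  -- Multiplying by `x_j ^ N` turns `p / x_j ^ N` back into `p`; clearing denominators leaves `x_j ^
  -- t p` in the power of the ideal, and the `x_j` are removed one by one.
  have h5 := Ideal.mul_mem_right
    (algebraMap (MvPolynomial (Fin (n + 1)) k) _ (X j ^ N)) _ (Ideal.pow_right_mono h3 m h4)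
  rw [chartToAway_frac, ← Ideal.map_pow, IsLocalization.algebraMap_mem_map_algebraMap_iff
    (Submonoid.powers (X j))] at h5
  obtain ⟨_, ⟨t, rfl⟩, h⟩ := h5
  dsimp only at h
  induction t with
  | zero => simpa using h
  | succ t ih =>
    rw [pow_succ', mul_assoc] at h
    exact ih (hj _ h)

/-- The global sections of `I ^ m 𝒪(N)`, for `I` the ideal sheaf of a linear subscheme, are the
homogeneous elements of degree `N` of the `m`-th power of the homogeneous ideal, provided that some
variable is a nonzerodivisor modulo this power. -/
theorem h0_idealTwist (hn : 0 < n)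
    (hI : ∀ j, I.ideal (PSpace.chart j) = Ideal.span (PSpace.dehomogenize j '' (W : Set _)))
    (N m : ℕ) (j : Fin (n + 1))
    (hj : ∀ q, X j * q ∈ linearIdeal W ^ m → q ∈ linearIdeal W ^ m) :
    h0 (PSpace.toSpec n k) (idealTwist (I ^ m) (twist (homogeneousSubmodule (Fin (n + 1)) k) N)) =
      Cardinal.toENat (Module.rank k ↥((linearIdeal W ^ m).restrictScalars k ⊓
        homogeneousSubmodule (Fin (n + 1)) k N)) := by
  let F := twist (homogeneousSubmodule (Fin (n + 1)) k) N
  let : Module k Γ(idealTwist (I ^ m) F, ⊤) :=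
    Module.compHom Γ(idealTwist (I ^ m) F, ⊤)
      ((Scheme.ΓSpecIso (.of k)).inv ≫ (PSpace.toSpec n k).appTop).hom
  unfold h0
  congr 1
  let φ : ↥((linearIdeal W ^ m).restrictScalars k ⊓ homogeneousSubmodule (Fin (n + 1)) k N) →ₗ[k]
      Γ(idealTwist (I ^ m) F, ⊤) :=
    { toFun := fun p ↦ (⟨twistOf _ ⊤ ⟨p.1, p.2.2⟩, twistOf_mem_of_mem_pow hI p.2.1⟩ :
        idealTwistSections (I ^ m) F ⊤)
      map_add' := fun p q ↦ Subtype.ext (twist_ext fun x ↦ map_add (toLoc x.1) _ _)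
      map_smul' := fun a p ↦ Subtype.ext (twist_ext fun x ↦ by
        refine Eq.trans ?_ (congrArg (· * toLoc x.1 p.1) (regularVal_toSpec a x.1).symm)
        refine Eq.trans ?_ (map_mul (toLoc x.1) _ _)
        exact congrArg (toLoc x.1) (smul_eq_C_mul _ _)) }
  refine (LinearEquiv.rank_eq (LinearEquiv.ofBijective φ ⟨?_, ?_⟩)).symm
  · intro p q hpq
    have h := congrArg (fun s : idealTwistSections (I ^ m) F ⊤ ↦
      twistVal (U := ⊤) s.1 ⟨genericPt n k, Opens.mem_top _⟩) hpq
    exact Subtype.ext (toLoc_injective (genericPt n k) h)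
  · intro s
    obtain ⟨p, hp⟩ := twistOf_surjective hn s.1
    refine ⟨⟨p.1, mem_pow_of_twistOf_mem hI j hj ?_, p.2⟩, Subtype.ext hp⟩
    rw [hp]
    exact s.2

/-- The dimension of the space of global sections of `𝒪(N)`. -/
theorem h0_twist (hn : 0 < n) (N : ℕ) :
    h0 (PSpace.toSpec n k) (twist (homogeneousSubmodule (Fin (n + 1)) k) N) =
      Cardinal.toENat (Module.rank k (homogeneousSubmodule (Fin (n + 1)) k N)) := by
  let F := twist (homogeneousSubmodule (Fin (n + 1)) k) N
  let : Module k Γ(F, ⊤) :=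
    Module.compHom Γ(F, ⊤) ((Scheme.ΓSpecIso (.of k)).inv ≫ (PSpace.toSpec n k).appTop).hom
  unfold h0
  congr 1
  let φ : homogeneousSubmodule (Fin (n + 1)) k N →ₗ[k] Γ(F, ⊤) :=
    { toFun := fun p ↦ twistOf _ ⊤ p
      map_add' := fun p q ↦ twist_ext fun x ↦ map_add (toLoc x.1) _ _
      map_smul' := fun a p ↦ twist_ext fun x ↦ by
        refine Eq.trans ?_ (congrArg (· * toLoc x.1 p.1) (regularVal_toSpec a x.1).symm)
        refine Eq.trans ?_ (map_mul (toLoc x.1) _ _)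
        exact congrArg (toLoc x.1) (smul_eq_C_mul _ _) }
  refine (LinearEquiv.rank_eq (LinearEquiv.ofBijective φ ⟨?_, twistOf_surjective hn⟩)).symm
  intro p q hpq
  have h := congrArg (twistVal (U := ⊤) · ⟨genericPt n k, Opens.mem_top _⟩) hpq
  exact Subtype.ext (toLoc_injective (genericPt n k) h)

end BetaConst

end

/-! ### Powers of coordinate ideals and counting of monomials -/

noncomputable section

namespace BetaConst

open MvPolynomial

section Monomial

variable {ι k : Type*} [Field k]

/-- The degree of a monomial in the variables in `T`. -/
def partialDegree (T : Finset ι) (d : ι →₀ ℕ) : ℕ := ∑ i ∈ T, d i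

lemma partialDegree_add (T : Finset ι) (d e : ι →₀ ℕ) :
    partialDegree T (d + e) = partialDegree T d + partialDegree T e := by
  simp [partialDegree, Finset.sum_add_distrib]

/-- The ideal of polynomials all of whose monomials have degree at least `m` in the variables
in `T`. -/
def orderIdeal (k : Type*) [Field k] (T : Finset ι) (m : ℕ) : Ideal (MvPolynomial ι k) where
  carrier := {p | ∀ d, coeff d p ≠ 0 → m ≤ partialDegree T d}
  add_mem' := by
    intro p q hp hq d hd
    rw [coeff_add] at hd
    by_cases h : coeff d p = 0
    · exact hq d (by rwa [h, zero_add] at hd)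
    · exact hp d h
  zero_mem' := by simp
  smul_mem' := by
    classical
    intro p q hq d hd
    have := support_mul p q (mem_support_iff.2 hd)
    obtain ⟨a, ha, b, hb, rfl⟩ := Finset.mem_add.1 this
    rw [partialDegree_add]
    exact (hq b (mem_support_iff.1 hb)).trans (Nat.le_add_left _ _)

lemma orderIdeal_mul_le (T : Finset ι) (l m : ℕ) :
    orderIdeal k T l * orderIdeal k T m ≤ orderIdeal k T (l + m) := by
  classical
  rw [Ideal.mul_le]
  intro p hp q hq d hd
  have := support_mul p q (mem_support_iff.2 hd)
  obtain ⟨a, ha, b, hb, rfl⟩ := Finset.mem_add.1 this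
  rw [partialDegree_add]
  exact add_le_add (hp a (mem_support_iff.1 ha)) (hq b (mem_support_iff.1 hb))

/-- Order of vanishing along a coordinate subspace is read off monomial by monomial: a monomial is
divisible by its `T`-part, a product of `partialDegree T d` generators. -/
lemma span_X_pow_eq (T : Finset ι) (m : ℕ) :
    Ideal.span (X '' (T : Set ι)) ^ m = orderIdeal k T m := by
  classical
  apply le_antisymm
  · induction m with
    | zero => intro p _ d _; exact Nat.zero_le _
    | succ m ih =>
      rw [pow_succ]
      refine (Ideal.mul_mono ih ?_).trans (orderIdeal_mul_le T m 1)
      rw [Ideal.span_le]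
      rintro _ ⟨i, hi, rfl⟩ d hd
      rw [coeff_X] at hd
      have : Finsupp.single i 1 = d := by by_contra h; simp [h] at hd
      subst this
      rw [partialDegree]
      refine le_trans ?_ (Finset.single_le_sum (fun _ _ ↦ Nat.zero_le _) hi)
      simp
  · intro p hp
    rw [p.as_sum]
    refine Ideal.sum_mem _ fun d hd ↦ ?_
    refine Ideal.pow_le_pow_right (hp d (mem_support_iff.1 hd)) ?_
    have h1 : (∏ i ∈ T, (X i : MvPolynomial ι k) ^ d i) ∣ monomial d (coeff d p) := by
      rw [monomial_eq, Finsupp.prod_of_support_subset d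
        (Finset.subset_union_left (s₂ := T)) _ (by simp)]
      exact (Finset.prod_dvd_prod_of_subset _ _ _ Finset.subset_union_right).mul_left _
    refine Ideal.mem_of_dvd _ h1 ?_
    rw [partialDegree]
    rw [← Finset.prod_pow_eq_pow_sum]
    exact Ideal.prod_mem_prod fun i hi ↦ Ideal.pow_mem_pow
      (Ideal.subset_span (Set.mem_image_of_mem X (Finset.mem_coe.2 hi))) _

/-- Multiplication by a variable outside `T` shifts monomials without changing their degree in `T`.
-/
lemma mem_orderIdeal_of_X_mul_mem {T : Finset ι} {m : ℕ} {i : ι} (hi : i ∉ T)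
    {q : MvPolynomial ι k} (h : X i * q ∈ orderIdeal k T m) : q ∈ orderIdeal k T m := by
  intro d hd
  have := h (Finsupp.single i 1 + d) (by rwa [coeff_X_mul])
  rw [partialDegree_add] at this
  classical
  have h0 : partialDegree T (Finsupp.single i 1) = 0 := by
    refine Finset.sum_eq_zero fun l hl ↦ ?_
    rw [Finsupp.single_apply, if_neg]
    rintro rfl
    exact hi hl
  omega

/-- Both conditions constrain only the support, so the admissible monomials form a basis. -/
lemma rank_orderIdeal_inf [Fintype ι] (T : Finset ι) (m N : ℕ) (D : Finset (ι →₀ ℕ))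
    (hD : ∀ d, d ∈ D ↔ d.degree = N) :
    Module.rank k ↥((orderIdeal k T m).restrictScalars k ⊓ homogeneousSubmodule ι k N) =
      (D.filter fun d ↦ m ≤ partialDegree T d).card := by
  have h : (orderIdeal k T m).restrictScalars k ⊓ homogeneousSubmodule ι k N =
      restrictSupport k (D.filter fun d ↦ m ≤ partialDegree T d : Set (ι →₀ ℕ)) := by
    ext p
    rw [mem_restrictSupport_iff]
    refine ⟨fun hp d hd ↦ ?_, fun hp ↦ ⟨fun d hd ↦ ?_, fun d hd ↦ ?_⟩⟩
    · have hd' := mem_support_iff.1 hd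
      refine Finset.mem_coe.2 (Finset.mem_filter.2 ⟨(hD d).2 ?_, hp.1 d hd'⟩)
      have := hp.2 hd'
      rw [Finsupp.degree_eq_weight_one]
      exact this
    · exact (Finset.mem_filter.1 (Finset.mem_coe.1 (hp (mem_support_iff.2 hd)))).2
    · have := (hD d).1 (Finset.mem_filter.1 (Finset.mem_coe.1 (hp (mem_support_iff.2 hd)))).1
      rw [Finsupp.degree_eq_weight_one] at this
      exact this
  rw [h, rank_eq_card_basis (basisRestrictSupport k _)]
  simp

/-- Summing the dimensions of the orders of vanishing. -/
lemma tsum_card_filter {α : Type*} (D : Finset α) (w : α → ℕ) :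
    ∑' m : ℕ, ((D.filter fun d ↦ m + 1 ≤ w d).card : ℝ≥0∞) = ((∑ d ∈ D, w d : ℕ) : ℝ≥0∞) := by
  simp only [Finset.card_filter, Nat.cast_sum]
  rw [Summable.tsum_finsetSum fun _ _ ↦ ENNReal.summable]
  refine Finset.sum_congr rfl fun d _ ↦ ?_
  -- The element `d` is counted exactly for `m = 0, …, w d - 1`, hence `w d` times.
  rw [tsum_eq_sum (s := Finset.range (w d))]
  · rw [Finset.sum_congr rfl (g := fun _ ↦ 1)]
    · simp
    · intro m hm
      rw [if_pos (Nat.succ_le_of_lt (Finset.mem_range.1 hm)), Nat.cast_one]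
  · intro m hm
    rw [if_neg (by simpa using hm), Nat.cast_zero]

/-- Swapping two variables permutes `D`, so all variables have the same total exponent; together
these totals make `N` for each monomial. -/
lemma card_mul_sum_partialDegree [Fintype ι] (T : Finset ι) (N : ℕ) (D : Finset (ι →₀ ℕ))
    (hD : ∀ d, d ∈ D ↔ d.degree = N) :
    Fintype.card ι * ∑ d ∈ D, partialDegree T d = T.card * (N * D.card) := by
  classical
  have hsymm : ∀ i j, ∑ d ∈ D, d i = ∑ d ∈ D, d j := by
    intro i j
    have hdeg : ∀ d ∈ D, Finsupp.equivMapDomain (Equiv.swap i j) d ∈ D := by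
      intro d hd
      rw [hD] at hd ⊢
      rw [← hd, Finsupp.degree_eq_sum, Finsupp.degree_eq_sum]
      exact Equiv.sum_comp (Equiv.swap i j).symm d
    refine Finset.sum_bij' (fun d _ ↦ Finsupp.equivMapDomain (Equiv.swap i j) d)
      (fun d _ ↦ Finsupp.equivMapDomain (Equiv.swap i j) d) hdeg hdeg ?_ ?_ ?_
    · intro d _
      ext l
      simp
    · intro d _
      ext l
      simp
    · intro d _
      simp
  have htot : ∑ i, ∑ d ∈ D, d i = N * D.card := by
    rw [Finset.sum_comm, Finset.sum_congr rfl (g := fun _ ↦ N)]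
    · simp [mul_comm]
    · intro d hd
      rw [← (hD d).1 hd, Finsupp.degree_eq_sum]
  simp only [partialDegree]
  rw [Finset.sum_comm, Finset.mul_sum, ← htot, ← smul_eq_mul T.card, ← Finset.sum_const]
  refine Finset.sum_congr rfl fun i _ ↦ ?_
  rw [Finset.sum_congr rfl (fun j _ ↦ hsymm j i)]
  simp

end Monomial

/-! ### Coordinate primes and adapted linear coordinates -/

lemma isPrime_span_X {ι k : Type*} [Field k] (T : Set ι) :
    (Ideal.span (X '' T : Set (MvPolynomial ι k))).IsPrime := by
  classical
  let ψ : MvPolynomial ι k →ₐ[k] MvPolynomial ι k := aeval fun i ↦ if i ∈ T then 0 else X i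
  -- Killing the variables in `T` changes nothing modulo the ideal they generate, so the kernel of
  -- `ψ` is that ideal; its target is a domain.
  have h1 : (Ideal.Quotient.mkₐ k (Ideal.span (X '' T))).comp ψ =
      Ideal.Quotient.mkₐ k (Ideal.span (X '' T)) := by
    refine algHom_ext fun i ↦ ?_
    simp only [AlgHom.comp_apply, ψ, aeval_X]
    split_ifs with h
    · rw [map_zero]
      exact (Ideal.Quotient.eq_zero_iff_mem.2 (Ideal.subset_span (Set.mem_image_of_mem X h))).symm
    · rfl
  have : Ideal.span (X '' T) = RingHom.ker ψ := by
    apply le_antisymm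
    · rw [Ideal.span_le]
      rintro _ ⟨i, hi, rfl⟩
      simp [ψ, hi]
    · intro p hp
      rw [← Ideal.Quotient.eq_zero_iff_mem]
      have h2 := AlgHom.congr_fun h1 p
      rw [AlgHom.comp_apply, show ψ p = 0 from hp, map_zero] at h2
      exact h2.symm
  rw [this]
  exact RingHom.ker_isPrime _

lemma X_mem_span_X_iff {ι k : Type*} [Field k] {T : Set ι} {i : ι} :
    (X i : MvPolynomial ι k) ∈ Ideal.span (X '' T) ↔ i ∈ T := by
  classical
  rw [mem_ideal_span_X_image]
  simp [support_X, Finsupp.single_apply]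

/-- Linear coordinates adapted to a space `W` of linear forms and a variable `x_j ∉ W`. -/
theorem exists_adapted_coordinates {n : ℕ} {k : Type u} [Field k]
    (W : Submodule k (homogeneousSubmodule (Fin (n + 1)) k 1)) (j : Fin (n + 1))
    (hj : (⟨X j, X_mem j⟩ : homogeneousSubmodule (Fin (n + 1)) k 1) ∉ W) :
    ∃ (φ : MvPolynomial (Fin (n + 1)) k ≃ₐ[k] MvPolynomial (Fin (n + 1)) k)
      (T : Finset (Fin (n + 1))) (i : Fin (n + 1)),
      (∀ N p, (φ p).IsHomogeneous N ↔ p.IsHomogeneous N) ∧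
      linearIdeal W = (Ideal.span (X '' (T : Set (Fin (n + 1))))).map φ ∧
      i ∉ T ∧ φ (X i) = X j := by
  classical
  let V := homogeneousSubmodule (Fin (n + 1)) k 1
  let x : Fin (n + 1) → V := fun i ↦ ⟨X i, X_mem i⟩
  have hx : LinearIndependent k x := LinearIndependent.of_comp V.subtype (linearIndependent_X _ _)
  have hspan : ⊤ ≤ Submodule.span k (Set.range x) := by
    have h1 : (Submodule.span k (Set.range x)).map V.subtype = V := by
      rw [Submodule.map_span, ← Set.range_comp]
      exact homogeneousSubmodule_one_eq_span_X.symm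
    rintro ⟨p, hp⟩ -
    obtain ⟨y, hy, rfl⟩ := h1.ge hp
    exact hy
  obtain ⟨b, T, i, hT, hi, hbi⟩ : ∃ (b : Module.Basis (Fin (n + 1)) k V) (T : Finset (Fin (n + 1)))
      (i : Fin (n + 1)), Submodule.span k (b '' (T : Set (Fin (n + 1)))) = W ∧ i ∉ T ∧
        b i = x j := by
    -- A basis of `W` stays independent after adjoining `x_j ∉ W`. It is extended to a basis of all
    -- linear forms and reindexed by the variables, with `T` marking the members from `W`.
    let w := Module.Basis.ofVectorSpace k W
    let s : Set V := Set.range (W.subtype ∘ w)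
    have hs : LinearIndepOn k id s :=
      (w.linearIndependent.map' W.subtype (Submodule.ker_subtype W)).linearIndepOn_id
    have hsW : Submodule.span k s = W := by
      rw [show s = W.subtype '' Set.range w from Set.range_comp _ _,
        ← Submodule.map_span, w.span_eq, Submodule.map_top,
        Submodule.range_subtype]
    have hs' : LinearIndepOn k id (insert (x j) s) := hs.id_insert (by rwa [hsW])
    let B := Module.Basis.extend hs'
    have hsub := hs'.subset_extend (Set.subset_univ _)
    let e := B.indexEquiv (Module.Basis.mk hx hspan)
    have hB : ∀ (v : V) (hv : v ∈ insert (x j) s), B.reindex e (e ⟨v, hsub hv⟩) = v := by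
      intro v hv
      simp [B]
    let T : Finset (Fin (n + 1)) := {l | B.reindex e l ∈ s}
    refine ⟨B.reindex e, T, e ⟨x j, hsub (Set.mem_insert _ _)⟩, ?_, ?_, hB _ (Set.mem_insert _ _)⟩
    · rw [← hsW]
      congr 1
      apply Set.Subset.antisymm
      · rintro _ ⟨l, hl, rfl⟩
        exact (Finset.mem_filter.1 (Finset.mem_coe.1 hl)).2
      · intro v hv
        refine ⟨e ⟨v, hsub (Set.mem_insert_of_mem _ hv)⟩, ?_, hB _ (Set.mem_insert_of_mem _ hv)⟩
        rw [Finset.mem_coe, Finset.mem_filter, hB v (Set.mem_insert_of_mem _ hv)]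
        exact ⟨Finset.mem_univ _, hv⟩
    · intro h
      rw [Finset.mem_filter, hB _ (Set.mem_insert _ _)] at h
      exact hj (hsW.le (Submodule.subset_span h.2))
  -- The map `g` substitutes `b l` for `x_l`, and `f` is the inverse substitution on linear forms,
  -- which `h` extends to polynomials.
  let f : V →ₗ[k] V := b.constr k fun l ↦ ⟨X l, X_mem l⟩
  let g : MvPolynomial (Fin (n + 1)) k →ₐ[k] MvPolynomial (Fin (n + 1)) k := aeval fun l ↦ (b l).1
  let h : MvPolynomial (Fin (n + 1)) k →ₐ[k] MvPolynomial (Fin (n + 1)) k :=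
    aeval fun l ↦ (f ⟨X l, X_mem l⟩).1
  have hlin : ∀ ℓ : V, h ℓ.1 = (f ℓ).1 := by
    have : h.toLinearMap ∘ₗ V.subtype = V.subtype ∘ₗ f := by
      refine LinearMap.ext_on (s := Set.range x) (top_le_iff.1 hspan) ?_
      rintro _ ⟨l, rfl⟩
      simp [h, x]
    exact LinearMap.congr_fun this
  have hgf : ∀ ℓ : V, g (f ℓ).1 = ℓ.1 := by
    have : g.toLinearMap ∘ₗ V.subtype ∘ₗ f = V.subtype := b.ext fun l ↦ by simp [f, g]
    exact LinearMap.congr_fun this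
  let φ := AlgEquiv.ofAlgHom g h (algHom_ext fun l ↦ by
      rw [AlgHom.comp_apply, AlgHom.id_apply]
      simp only [h, aeval_X]
      exact hgf _) (algHom_ext fun l ↦ by
      rw [AlgHom.comp_apply, AlgHom.id_apply]
      simp only [g, aeval_X]
      rw [hlin]
      simp [f])
  have hφ : ∀ l, φ (X l) = (b l).1 := fun l ↦ by simp [φ, g]
  refine ⟨φ, T, i, fun N p ↦ ⟨fun hp ↦ ?_, fun hp ↦ ?_⟩, ?_, hi, by rw [hφ, hbi]⟩
  · have := hp.aeval (fun l ↦ (f ⟨X l, X_mem l⟩).1) (n := 1) fun l ↦ (f _).2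
    rw [one_mul] at this
    rwa [show aeval (fun l ↦ (f ⟨X l, X_mem l⟩).1) (φ p) = p from φ.symm_apply_apply p] at this
  · have := hp.aeval (fun l ↦ (b l).1) (n := 1) fun l ↦ (b l).2
    rwa [one_mul] at this
  · rw [Ideal.map_span, Set.image_image, linearIdeal]
    apply le_antisymm
    · rw [Ideal.span_le]
      rintro _ ⟨ℓ, hℓ, rfl⟩
      rw [← hT] at hℓ
      have h1 : Submodule.span k (b '' (T : Set (Fin (n + 1)))) ≤ ((Ideal.span ((fun l ↦ φ (X l)) ''
          (T : Set (Fin (n + 1))))).restrictScalars k).comap V.subtype := by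
        rw [Submodule.span_le]
        rintro _ ⟨l, hl, rfl⟩
        exact Ideal.subset_span ⟨l, hl, hφ l⟩
      exact h1 hℓ
    · rw [Ideal.span_le]
      rintro _ ⟨l, hl, rfl⟩
      refine Ideal.subset_span ⟨b l, ?_, (hφ l).symm⟩
      rw [← hT]
      exact Submodule.subset_span ⟨l, hl, rfl⟩

end BetaConst

end

/-! ### Codimension of a linear subscheme -/

noncomputable section

namespace BetaConst

open Scheme.Modules MvPolynomial

attribute [local instance] MvPolynomial.gradedAlgebra

variable {n : ℕ} {k : Type u} [Field k]

/-- The stalk is the degree `0` part of the local ring of `A`, and invertibility may be tested in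
the whole local ring. -/
lemma mem_basicOpen_iff_isUnit_regularVal {σ : Type*} {A : Type u} [CommRing A] [SetLike σ A]
    [AddSubgroupClass σ A] {𝒜 : ℕ → σ} [GradedRing 𝒜] {U : (Proj 𝒜).Opens} (f : Γ(Proj 𝒜, U))
    (x : U) : x.1 ∈ (Proj 𝒜).basicOpen f ↔ IsUnit (regularVal f x) := by
  rw [Scheme.mem_basicOpen', regularVal, HomogeneousLocalization.isUnit_iff_isUnit_val]
  refine (MulEquiv.isUnit_map (Proj.stalkIso' 𝒜 x.1)).symm.trans (iff_of_eq (congrArg IsUnit ?_))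
  exact Proj.stalkIso'_germ 𝒜 U x.1 x.2 f

lemma mem_basicOpen_dehomogenize_iff (j : Fin (n + 1))
    (ℓ : homogeneousSubmodule (Fin (n + 1)) k 1) (x : (PSpace.chart (k := k) j).1) :
    x.1 ∈ (PSpace n k).basicOpen (PSpace.dehomogenize j ℓ) ↔
      ℓ.1 ∉ (show ProjectiveSpectrum (homogeneousSubmodule (Fin (n + 1)) k)
        from x.1).asHomogeneousIdeal.toIdeal := by
  have h := regularVal_frac j ℓ x
  have hu : IsUnit (toLoc x.1 (X j ^ 1)) := by
    rw [map_pow]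
    exact (isUnit_algebraMap_locAt x.2).pow _
  rw [mem_basicOpen_iff_isUnit_regularVal, ← hu.mul_right_iff]
  refine (iff_of_eq (congrArg IsUnit h)).trans ?_
  exact IsLocalization.AtPrime.isUnit_to_map_iff _ _ _

/-- A linear subscheme consists of the points at which its linear equations vanish. -/
lemma mem_range_iff_linearIdeal_le {Y : Scheme.{u}} (i : Y ⟶ PSpace n k) [IsClosedImmersion i]
    {W : Submodule k (homogeneousSubmodule (Fin (n + 1)) k 1)}
    (hW : ∀ j, i.ker.ideal (PSpace.chart j) = Ideal.span (PSpace.dehomogenize j '' (W : Set _)))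
    (x : PSpace n k) : x ∈ Set.range i ↔ linearIdeal W ≤
      (show ProjectiveSpectrum (homogeneousSubmodule (Fin (n + 1)) k)
        from x).asHomogeneousIdeal.toIdeal := by
  obtain ⟨j, hj⟩ := exists_mem_chart x
  rw [← i.isClosedEmbedding.isClosed_range.closure_eq, ← Scheme.Hom.support_ker, SetLike.mem_coe,
    Scheme.IdealSheafData.mem_support_iff_of_mem hj, hW, Scheme.zeroLocus_span,
    Scheme.mem_zeroLocus_iff, Set.forall_mem_image, linearIdeal, Ideal.span_le,
    Set.image_subset_iff]
  refine forall₂_congr fun ℓ _ ↦ ?_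
  exact (not_congr (mem_basicOpen_dehomogenize_iff j ℓ ⟨x, hj⟩)).trans not_not

/-- The ideal generated by the images under `φ` of the variables in `A`. -/
def coordIdeal (φ : MvPolynomial (Fin (n + 1)) k ≃ₐ[k] MvPolynomial (Fin (n + 1)) k)
    (A : Finset (Fin (n + 1))) : Ideal (MvPolynomial (Fin (n + 1)) k) :=
  (Ideal.span (X '' (A : Set (Fin (n + 1))))).map φ

section Coord

variable (φ : MvPolynomial (Fin (n + 1)) k ≃ₐ[k] MvPolynomial (Fin (n + 1)) k)

lemma coordIdeal_eq_span (A : Finset (Fin (n + 1))) :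
    coordIdeal φ A = Ideal.span ((fun l ↦ φ (X l)) '' (A : Set (Fin (n + 1)))) := by
  rw [coordIdeal, Ideal.map_span, Set.image_image]

lemma isPrime_coordIdeal (A : Finset (Fin (n + 1))) : (coordIdeal φ A).IsPrime :=
  have := isPrime_span_X (k := k) (A : Set (Fin (n + 1)))
  Ideal.map_isPrime_of_equiv φ

lemma apply_mem_map_iff (I : Ideal (MvPolynomial (Fin (n + 1)) k))
    (p : MvPolynomial (Fin (n + 1)) k) : φ p ∈ I.map φ ↔ p ∈ I := by
  refine ⟨fun h ↦ ?_, fun h ↦ Ideal.mem_map_of_mem _ h⟩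
  obtain ⟨q, hq, hqp⟩ := (Ideal.mem_map_of_equiv φ _).1 h
  rwa [← φ.injective hqp]

lemma apply_X_mem_coordIdeal_iff {A : Finset (Fin (n + 1))} {l : Fin (n + 1)} :
    φ (X l) ∈ coordIdeal φ A ↔ l ∈ A := by
  rw [coordIdeal, apply_mem_map_iff, X_mem_span_X_iff, Finset.mem_coe]

variable (hφ : ∀ l, φ (X l) ∈ homogeneousSubmodule (Fin (n + 1)) k 1)

/-- The generic point of the coordinate subspace on which the linear forms `φ x_l`, `l ∈ A`,
vanish. -/
def coordPt (A : Finset (Fin (n + 1))) (i : Fin (n + 1)) (hi : i ∉ A) : PSpace n k :=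
  (⟨⟨coordIdeal φ A, by
      rw [coordIdeal_eq_span]
      refine Ideal.homogeneous_span _ _ ?_
      rintro _ ⟨l, -, rfl⟩
      exact ⟨1, hφ l⟩⟩, isPrime_coordIdeal φ A, fun h ↦ by
    have h1 : φ (X i) ∈ HomogeneousIdeal.irrelevant (homogeneousSubmodule (Fin (n + 1)) k) := by
      rw [HomogeneousIdeal.mem_irrelevant_iff]
      exact DirectSum.decompose_of_mem_ne _ (hφ i) one_ne_zero
    exact hi ((apply_X_mem_coordIdeal_iff φ).1 (h h1))⟩ :
    ProjectiveSpectrum (homogeneousSubmodule (Fin (n + 1)) k))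

lemma mem_closure_coordPt {A : Finset (Fin (n + 1))} {i : Fin (n + 1)} (hi : i ∉ A)
    (x : PSpace n k) : x ∈ closure {coordPt φ hφ A i hi} ↔ coordIdeal φ A ≤
      (show ProjectiveSpectrum (homogeneousSubmodule (Fin (n + 1)) k)
        from x).asHomogeneousIdeal.toIdeal :=
  (ProjectiveSpectrum.le_iff_mem_closure _ (coordPt φ hφ A i hi) x).symm

/-- The closure of a point, as an irreducible closed subset. -/
def irredClosure {Z : Type*} [TopologicalSpace Z] (x : Z) : IrreducibleCloseds Z :=
  ⟨closure {x}, isIrreducible_singleton.closure, isClosed_closure⟩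

/-- Dropping the equations one at a time gives a chain of coordinate subspaces; each step is strict
because a coordinate outside `A` is not in the ideal of `A`. -/
lemma le_coheight_coordPt {i : Fin (n + 1)} (A : Finset (Fin (n + 1))) (hi : i ∉ A) :
    (A.card : ℕ∞) ≤ Order.coheight (irredClosure (coordPt φ hφ A i hi)) := by
  classical
  induction A using Finset.induction_on with
  | empty => simp
  | insert a A ha ih =>
    have hi' : i ∉ A := fun h ↦ hi (Finset.mem_insert_of_mem h)
    have hlt : irredClosure (coordPt φ hφ (insert a A) i hi) <
        irredClosure (coordPt φ hφ A i hi') := by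
      refine lt_of_le_not_ge (fun x hx ↦ ?_) fun h ↦ ?_
      · refine (mem_closure_coordPt φ hφ hi' x).2
          (le_trans ?_ ((mem_closure_coordPt φ hφ hi x).1 hx))
        exact Ideal.map_mono (Ideal.span_mono (Set.image_mono (by simp)))
      · have h1 : coordIdeal φ (insert a A) ≤ coordIdeal φ A :=
          (mem_closure_coordPt φ hφ hi _).1 (h (subset_closure (Set.mem_singleton _)))
        exact ha ((apply_X_mem_coordIdeal_iff φ).1
          (h1 ((apply_X_mem_coordIdeal_iff φ).2 (Finset.mem_insert_self a A))))
    rw [Finset.card_insert_of_notMem ha, Nat.cast_add, Nat.cast_one]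
    exact (add_le_add_left (ih hi') 1).trans (Order.coheight_add_one_le hlt)

/-- The homogeneous prime ideal of an irreducible closed subset of projective space. -/
def primeOfIrred (Z : IrreducibleCloseds (PSpace n k)) :
    PrimeSpectrum (MvPolynomial (Fin (n + 1)) k) :=
  let x : ProjectiveSpectrum (homogeneousSubmodule (Fin (n + 1)) k) :=
    irreducibleSetEquivPoints (α := PSpace n k) Z
  ⟨x.asHomogeneousIdeal.toIdeal, x.isPrime⟩

/-- Transfers chains of irreducible closed subsets to chains of primes of the polynomial ring, so
codimension is at most the height of the homogeneous prime. -/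
lemma strictMono_toDual_primeOfIrred :
    StrictMono fun Z : IrreducibleCloseds (PSpace n k) ↦ OrderDual.toDual (primeOfIrred Z) := by
  refine Monotone.strictMono_of_injective (fun Z Z' h ↦ ?_) fun Z Z' h ↦ ?_
  · have h1 : irreducibleSetEquivPoints Z ∈ closure {irreducibleSetEquivPoints Z'} :=
      ((irreducibleSetEquivPoints (α := PSpace n k)).monotone h).mem_closure
    exact (ProjectiveSpectrum.le_iff_mem_closure _ _ _).2 h1
  · refine irreducibleSetEquivPoints.injective ?_
    have h1 : (primeOfIrred Z).asIdeal = (primeOfIrred Z').asIdeal :=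
      congrArg PrimeSpectrum.asIdeal h
    exact ProjectiveSpectrum.ext (HomogeneousIdeal.toIdeal_injective h1)

/-- Krull's height theorem: the ideal is prime, hence minimal over itself, and is generated by at
most `A.card` elements. -/
lemma coheight_coordPt_le {i : Fin (n + 1)} (A : Finset (Fin (n + 1))) (hi : i ∉ A) :
    Order.coheight (irredClosure (coordPt φ hφ A i hi)) ≤ A.card := by
  classical
  refine (Order.coheight_le_coheight_apply_of_strictMono _ strictMono_toDual_primeOfIrred
    _).trans ?_
  have h1 : primeOfIrred (irredClosure (coordPt φ hφ A i hi)) =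
      ⟨coordIdeal φ A, isPrime_coordIdeal φ A⟩ := by
    have h2 : irreducibleSetEquivPoints (irredClosure (coordPt φ hφ A i hi)) =
      coordPt φ hφ A i hi := irreducibleSetEquivPoints.apply_symm_apply _
    exact PrimeSpectrum.ext (congrArg (fun x : ProjectiveSpectrum
      (homogeneousSubmodule (Fin (n + 1)) k) ↦ x.asHomogeneousIdeal.toIdeal) h2)
  rw [Order.coheight_toDual, h1, ← PrimeSpectrum.height_eq_orderHeight]
  refine (Ideal.height_le_card_of_mem_minimalPrimes_span_finset
    (s := A.image fun l ↦ φ (X l)) ?_).trans (by exact_mod_cast Finset.card_image_le)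
  have := isPrime_coordIdeal φ A
  rw [Finset.coe_image, ← coordIdeal_eq_span, Ideal.minimalPrimes_eq_subsingleton_self]
  rfl

end Coord

/-- The codimension of the linear subscheme cut out by `T.card` independent linear forms. -/
theorem codim_eq_card {Y : Scheme.{u}} (i : Y ⟶ PSpace n k) [IsClosedImmersion i]
    [IrreducibleSpace Y] {W : Submodule k (homogeneousSubmodule (Fin (n + 1)) k 1)}
    (hW : ∀ j, i.ker.ideal (PSpace.chart j) = Ideal.span (PSpace.dehomogenize j '' (W : Set _)))
    {φ : MvPolynomial (Fin (n + 1)) k ≃ₐ[k] MvPolynomial (Fin (n + 1)) k}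
    (hφ : ∀ l, φ (X l) ∈ homogeneousSubmodule (Fin (n + 1)) k 1)
    {T : Finset (Fin (n + 1))} (hT : linearIdeal W = coordIdeal φ T) {l : Fin (n + 1)}
    (hl : l ∉ T) : codim i = T.card := by
  refine Eq.trans ?_ (le_antisymm (coheight_coordPt_le φ hφ T hl) (le_coheight_coordPt φ hφ T hl))
  refine congrArg Order.coheight (IrreducibleCloseds.ext (Set.ext fun x ↦ ?_))
  refine (mem_range_iff_linearIdeal_le i hW x).trans ?_
  rw [hT]
  exact (mem_closure_coordPt φ hφ hl x).symm

/-- If a linear subscheme is nonempty, then some variable does not vanish on it. -/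
lemma exists_X_notMem {Y : Scheme.{u}} [Nonempty Y] (i : Y ⟶ PSpace n k) [IsClosedImmersion i]
    {W : Submodule k (homogeneousSubmodule (Fin (n + 1)) k 1)}
    (hW : ∀ j, i.ker.ideal (PSpace.chart j) = Ideal.span (PSpace.dehomogenize j '' (W : Set _))) :
    ∃ j : Fin (n + 1), (⟨X j, X_mem j⟩ : homogeneousSubmodule (Fin (n + 1)) k 1) ∉ W := by
  obtain ⟨y⟩ := ‹Nonempty Y›
  obtain ⟨j, hj⟩ := exists_mem_chart (i y)
  exact ⟨j, fun h ↦ hj ((mem_range_iff_linearIdeal_le i hW _).1 ⟨y, rfl⟩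
    (Ideal.subset_span ⟨_, h, rfl⟩))⟩

end BetaConst

end

/-! ### Dimensions as monomial counts, and the value of `β` -/

noncomputable section

namespace BetaConst

open Scheme.Modules MvPolynomial

attribute [local instance] MvPolynomial.gradedAlgebra

variable {n : ℕ} {k : Type u} [Field k]

/-- The exponents of the monomials of degree `N` in `n + 1` variables. -/
def degreeFinset (n N : ℕ) : Finset (Fin (n + 1) →₀ ℕ) :=
  Finset.finsuppAntidiag Finset.univ N

lemma mem_degreeFinset (N : ℕ) (d : Fin (n + 1) →₀ ℕ) :
    d ∈ degreeFinset n N ↔ d.degree = N := by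
  rw [degreeFinset, Finset.mem_finsuppAntidiag, Finsupp.degree_eq_sum]
  simp

lemma degreeFinset_card_ne_zero (N : ℕ) : (degreeFinset n N).card ≠ 0 := by
  refine Finset.card_ne_zero_of_mem (a := Finsupp.single 0 N) ((mem_degreeFinset N _).2 ?_)
  simp

lemma nonempty_tensorPow_O1_iso {N : ℕ} (hN : 0 < N) : Nonempty (tensorPow (PSpace.O1 n k) N ≅
    twist (homogeneousSubmodule (Fin (n + 1)) k) N) := by
  obtain ⟨N, rfl⟩ := Nat.exists_eq_succ_of_ne_zero hN.ne'
  refine nonempty_tensorPow_iso _ (fun x ↦ ?_) N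
  obtain ⟨j, hj⟩ := exists_mem_chart x
  exact ⟨⟨X j, X_mem j⟩, hj⟩

lemma h0_tensorPow (hn : 0 < n) {N : ℕ} (hN : 0 < N) :
    h0 (PSpace.toSpec n k) (tensorPow (PSpace.O1 n k) N) = (degreeFinset n N).card := by
  obtain ⟨e⟩ := nonempty_tensorPow_O1_iso (n := n) (k := k) hN
  -- With `m = 0` the vanishing condition is empty, so the general count covers all forms of degree
  -- `N`.
  have h := rank_orderIdeal_inf (k := k) ∅ 0 N _ (mem_degreeFinset (n := n) N)
  have h1 : (orderIdeal k (∅ : Finset (Fin (n + 1))) 0).restrictScalars k ⊓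
      homogeneousSubmodule (Fin (n + 1)) k N = homogeneousSubmodule (Fin (n + 1)) k N :=
    inf_eq_right.2 fun _ _ _ _ ↦ Nat.zero_le _
  rw [h0_congr _ e, h0_twist hn, ← h1, h]
  simp

section Linear

variable {W : Submodule k (homogeneousSubmodule (Fin (n + 1)) k 1)}
  {φ : MvPolynomial (Fin (n + 1)) k ≃ₐ[k] MvPolynomial (Fin (n + 1)) k}
  {T : Finset (Fin (n + 1))}

lemma linearIdeal_pow_eq (hT : linearIdeal W = coordIdeal φ T) (m : ℕ) :
    linearIdeal W ^ m = (orderIdeal k T m).map φ := by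
  rw [hT, coordIdeal, ← Ideal.map_pow, span_X_pow_eq]

lemma mem_linearIdeal_pow_of_X_mul_mem (hT : linearIdeal W = coordIdeal φ T)
    {l j : Fin (n + 1)} (hl : l ∉ T) (hj : φ (X l) = X j) (m : ℕ)
    (q : MvPolynomial (Fin (n + 1)) k) (hq : X j * q ∈ linearIdeal W ^ m) :
    q ∈ linearIdeal W ^ m := by
  rw [linearIdeal_pow_eq hT] at hq ⊢
  obtain ⟨q, rfl⟩ := φ.surjective q
  rw [← hj, ← map_mul, apply_mem_map_iff] at hq
  exact Ideal.mem_map_of_mem _ (mem_orderIdeal_of_X_mul_mem hl hq)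

/-- The coordinate change preserves degrees in both directions, so it carries the graded pieces of
the monomial ideal onto those of the power of `linearIdeal W`. -/
lemma rank_linearIdeal_pow_inf (hT : linearIdeal W = coordIdeal φ T)
    (hφ : ∀ N p, (φ p).IsHomogeneous N ↔ p.IsHomogeneous N) (m N : ℕ) :
    Module.rank k ↥((linearIdeal W ^ m).restrictScalars k ⊓
      homogeneousSubmodule (Fin (n + 1)) k N) =
        ((degreeFinset n N).filter fun d ↦ m ≤ partialDegree T d).card := by
  rw [← rank_orderIdeal_inf (k := k) T m N _ (mem_degreeFinset N)]
  have h : (linearIdeal W ^ m).restrictScalars k ⊓ homogeneousSubmodule (Fin (n + 1)) k N =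
      ((orderIdeal k T m).restrictScalars k ⊓ homogeneousSubmodule (Fin (n + 1)) k N).map
        φ.toLinearEquiv.toLinearMap := by
    ext p
    obtain ⟨p, rfl⟩ := φ.surjective p
    rw [linearIdeal_pow_eq hT]
    refine Iff.trans ?_ (Submodule.mem_map_equiv (e := φ.toLinearEquiv) _).symm
    rw [show φ.toLinearEquiv.symm (φ p) = p from φ.symm_apply_apply p]
    exact and_congr (apply_mem_map_iff φ _ p) (hφ N p)
  rw [h]
  exact (φ.toLinearEquiv.submoduleMap _).rank_eq.symm

lemma h0_sheafTensor_tensorPow_idealModule (hn : 0 < n) {I : (PSpace n k).IdealSheafData}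
    (hI : ∀ j, I.ideal (PSpace.chart j) = Ideal.span (PSpace.dehomogenize j '' (W : Set _)))
    (hT : linearIdeal W = coordIdeal φ T)
    (hφ : ∀ N p, (φ p).IsHomogeneous N ↔ p.IsHomogeneous N)
    {l j : Fin (n + 1)} (hl : l ∉ T) (hj : φ (X l) = X j) {N : ℕ} (hN : 0 < N) (m : ℕ) :
    h0 (PSpace.toSpec n k) (sheafTensor (tensorPow (PSpace.O1 n k) N) (idealModule (I ^ m))) =
      ((degreeFinset n N).filter fun d ↦ m ≤ partialDegree T d).card := by
  obtain ⟨e⟩ := nonempty_tensorPow_O1_iso (n := n) (k := k) hN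
  rw [h0_congr _ (sheafTensorCongr e (Iso.refl _) ≪≫ sheafTensorIdealIso fun x ↦ ?_),
    h0_idealTwist hn hI N m j (mem_linearIdeal_pow_of_X_mul_mem hT hl hj m),
    rank_linearIdeal_pow_inf hT hφ]
  · simp
  · obtain ⟨j, hj⟩ := exists_mem_chart x
    exact ⟨_, _, hj, isGenerator_XPow j N⟩

end Linear

end BetaConst

end

theorem proposition9p2 {k : Type u} [Field k] {n : ℕ} (hn : 0 < n)
    {Y : Scheme.{u}} (i : Y ⟶ BetaConst.PSpace n k) [IsClosedImmersion i] [IsIntegral Y]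
    (hlin : BetaConst.IsLinearSubscheme i) {r : ℕ} (hr : 0 < r)
    (hcodim : BetaConst.codim i = (r : ℕ∞)) :
    BetaConst.beta (BetaConst.PSpace.toSpec n k) (BetaConst.PSpace.O1 n k) i =
      (r : ℝ≥0∞) / ((n : ℝ≥0∞) + 1) := by
  obtain ⟨W, hW⟩ := hlin
  obtain ⟨j, hj⟩ := BetaConst.exists_X_notMem i hW
  obtain ⟨φ, T, l, hφ, hT, hl, hlj⟩ := BetaConst.exists_adapted_coordinates W j hj
  have hTr : T.card = r := by
    rw [BetaConst.codim_eq_card i hW (fun l ↦ (hφ 1 _).2 (MvPolynomial.isHomogeneous_X k l)) hT hl]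
      at hcodim
    exact_mod_cast hcodim
  -- The quotient is constant for `N > 0`; only `N = 0`, where its denominator is zero, has to be
  -- discarded.
  refine (liminf_congr ((eventually_gt_atTop 0).mono fun N hN ↦ ?_)).trans
    (liminf_const ((r : ℝ≥0∞) / ((n : ℝ≥0∞) + 1)))
  rw [BetaConst.h0_tensorPow hn hN]
  simp only [BetaConst.h0_sheafTensor_tensorPow_idealModule hn hW hT hφ hl hlj hN,
    ENat.toENNReal_coe]
  rw [BetaConst.tsum_card_filter]
  have h := BetaConst.card_mul_sum_partialDegree T N _ (BetaConst.mem_degreeFinset (n := n) N)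
  rw [Fintype.card_fin, hTr] at h
  have hD := BetaConst.degreeFinset_card_ne_zero (n := n) N
  -- Cross-multiplication in `ℝ≥0∞` needs a nonzero denominator: `N > 0`, and there is a monomial of
  -- degree `N`. What remains is the counting identity `h`.
  have hND : ((N : ℝ≥0∞) * ((BetaConst.degreeFinset n N).card : ℝ≥0∞)) ≠ 0 := by
    exact_mod_cast mul_ne_zero hN.ne' hD
  rw [ENNReal.div_eq_div_iff (by simp) (by finiteness) hND (by finiteness)]
  have h' := congrArg (Nat.cast (R := ℝ≥0∞)) h
  push_cast at h' ⊢
  rw [h']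
  ring
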